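/- **Setting.** Let $d\ge 1$, let $\lambda_d$ be Lebesgue measure on $\mathbb R^d$ and $B_r=\{x:\|x\|<r\}$. Let $(\Omega,\mathcal A,\mathbb P)$ be a probability space with a jointly measurable, $\mathbb P$-preserving action $\theta_x$, $x\in\mathbb R^d$, of the translation group. A random measure is a measurable map $\Phi$ from $\Omega$ to the locally finite (nonnegative) Borel measures on $\mathbb R^d$; it is *invariant* if $\Phi(\theta_x\omega,B-x)=\Phi(\omega,B)$ for all $x,\omega,B$, *locally square-integrable* if $\mathbb E[\Phi(B_1)^2]<\infty$, and has intensity $\gamma\in[0,\infty)$ if $\mathbb E[\Phi]=\gamma\lambda_d$. For such $\Phi$, put $\alpha_\Phi(B)=\mathbb E\big[\iint \mathbf 1\{x\in[0,1)^d,\ x-y\in B\}\,\Phi(dx)\Phi(dy)\big]$ and $\beta_\Phi=\alpha_\Phi-\gamma^2\lambda_d$. The *Bartlett spectral measure* $\hat\beta_\Phi$ is the locally finite measure with $\beta_\Phi(f\star g)=\int\hat f\,\overline{\hat g}\,d\hat\beta_\Phi$ for all bounded measurable $f,g:\mathbb R^d\to\mathbb C$ with bounded support, where $(f\star g)(y)=\int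 f(x)\overline{g(x-y)}\,dx$ and $\hat f(k)=\int e^{-i\langle k,x\rangle}f(x)\,dx$. $\Phi$ is *$\infty$-uniform* if $\hat\beta_\Phi(B_\varepsilon)=0$ for some $\varepsilon>0$. An *invariant probability kernel* is a probability kernel $K$ from $\Omega\times\mathbb R^d$ to $\mathbb R^d$ with $K(\theta_z\omega,x-z,B-z)=K(\omega,x,B)$ for all $z,\omega,x,B$. Write $K_x=K(\cdot,x,\cdot)$ and $K\Phi(\omega,\cdot)=\int K(\omega,x,\cdot)\,\Phi(\omega,dx)$. It is *deterministic* if it does not depend on $\omega$. Identities between random objects are understood almost surely, and a random variable is called deterministic if it is almost surely constant. For $p\ge1$ and an invariant random measure $\Phi$ of intensity $\gamma$ let $$\tilde d_p(\Phi,\gamma\lambda_d)=\inf\Big\{\mathbb E\Big[\int\|x\|^pK_0(dx)\Big]\Big\},$$ the infimum over invariant probability kernels $K$ with $\Phi=\gamma K\lambda_d$ such that $\int x^{\otimes q}K_0(dx)$ is deterministic for all integers $1\le q\le \frac p2-1$; let $$d_p(\Phi,\gamma\lambda_d)=\inf\Big\{\mathbb E\Big[\int\|x\|^p(K_0+L_0)(dx)\Big]\Big\},$$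 the infimum over pairs of invariant probability kernels $K,L$ with $\Phi=\gamma K\lambda_d$, $\lambda_d=L\lambda_d$ and $\int x^{\otimes q}(K_0-L_0)(dx)=0$ for all integers $1\le q\le\frac p2-1$. For invariant random measures $\Phi,\Psi$ of the same intensity $\gamma>0$ let $$W_p(\Phi,\Psi)=\inf\Big\{\Big(\mathbb E_0^\Phi\Big[\int\|x\|^pK_0(dx)\Big]\Big)^{1/p}\Big\},$$ the infimum over invariant probability kernels $K$ with $\Psi=K\Phi$, where $\mathbb E_0^\Phi$ is the expectation under the Palm probability measure $\mathbb P_0^\Phi(A)=\gamma^{-1}\,\mathbb E\big[\int_{[0,1)^d}\mathbf 1\{\theta_x\omega\in A\}\,\Phi(\omega,dx)\big]$. **Theorem.** Let $\Psi$ be an invariant, locally square-integrable, $\infty$-uniform random measure of intensity $\gamma\in[0,\infty)$. Then there exist invariant probability kernels $K,L$, with $L$ deterministic, such that $\Psi=\gamma K\lambda_d$, $\lambda_d=L\lambda_d$, and for all $q\in\mathbb N$ $$\mathbb E\Big[\int\|x\|^q\,(K_0+L_0)(dx)\Big]<\infty,\qquad \int x^{\otimes q}\,(K_0-L_0)(dx)=0,$$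 so that $\int x^{\otimes q}K_0(dx)$ is deterministic for every $q\in\mathbb N$. Moreover, for all $p\in[1,\infty)$, $$d_p(\Psi,\gamma\lambda_d)\le 2\,\tilde d_p(\Psi,\gamma\lambda_d)<\infty ,$$ and, if $\gamma>0$, the $p$-Wasserstein distances between $\Psi$ and $\gamma\lambda_d$ are finite: $W_p(\gamma\lambda_d,\Psi)<\infty$ and $W_p(\Psi,\gamma\lambda_d)<\infty$. -/

import Mathlib

open MeasureTheory ProbabilityTheory
open scoped NNReal ENNReal ComplexConjugate

noncomputable section

namespace StealthyTransport

/-- Euclidean space `ℝ^d`. -/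
abbrev E (d : ℕ) : Type := EuclideanSpace ℝ (Fin d)

/-- The half-open unit cube `[0,1)^d`. -/
def unitCube (d : ℕ) : Set (E d) := {x | ∀ i, 0 ≤ x i ∧ x i < 1}

section Probability

variable {d : ℕ} {Ω : Type*} [MeasurableSpace Ω]

/-! ### Random measures

A (nonnegative) random measure on `ℝ^d` is a measurable map `Φ` from `Ω` to the measures on
`ℝ^d` (a Mathlib kernel) all of whose values are locally finite.  The shift group is an action of
`ℝ^d` on `Ω`, and `θ_x ω` is written `x +ᵥ ω`. -/

/-- Every realization of `Φ` is a locally finite measure. -/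
def IsRandomMeasure (Φ : Kernel Ω (E d)) : Prop :=
  ∀ ω, IsLocallyFiniteMeasure (Φ ω)

/-- Invariance: `Φ(θ_x ω, B - x) = Φ(ω, B)` for all `x`, `ω` and Borel sets `B`. -/
def IsInvariant [AddAction (E d) Ω] (Φ : Kernel Ω (E d)) : Prop :=
  ∀ (x : E d) (ω : Ω), Φ (x +ᵥ ω) = (Φ ω).map (fun y => y - x)

/-- Local square integrability: `𝔼[Φ(B_1)^2] < ∞`. -/
def IsLocallySquareIntegrable (P : Measure Ω) (Φ : Kernel Ω (E d)) : Prop :=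
  ∫⁻ ω, (Φ ω (Metric.ball 0 1)) ^ 2 ∂P < ∞

/-- `Φ` has (finite) intensity `γ`: `𝔼[Φ] = γ λ_d`. -/
def HasIntensity (P : Measure Ω) (Φ : Kernel Ω (E d)) (γ : ℝ≥0) : Prop :=
  P.bind Φ = γ • (volume : Measure (E d))

/-! ### Second moments and the Bartlett spectral measure -/

/-- The reduced second moment measure
`α_Φ(B) = 𝔼[∬ 1{x ∈ [0,1)^d, x - y ∈ B} Φ(dx) Φ(dy)]`. -/
def reducedSecondMoment (P : Measure Ω) (Φ : Kernel Ω (E d)) : Measure (E d) :=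
  P.bind fun ω =>
    (((Φ ω).restrict (unitCube d)).prod (Φ ω)).map (fun z : E d × E d => z.1 - z.2)

/-- Integration of `h` against the covariance measure `β_Φ = α_Φ - γ^2 λ_d`, a locally finite
signed measure; used only for `h` continuous with compact support. -/
def covarianceIntegral (P : Measure Ω) (Φ : Kernel Ω (E d)) (γ : ℝ≥0) (h : E d → ℂ) : ℂ :=
  (∫ x, h x ∂(reducedSecondMoment P Φ)) - ((γ : ℝ) : ℂ) ^ 2 * ∫ x, h x

/-- The Fourier transform `f̂(k) = ∫ exp(-i⟨k,x⟩) f(x) dx`. -/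
def fourierHat (f : E d → ℂ) (k : E d) : ℂ :=
  ∫ x, Complex.exp (-(Complex.I * ((inner ℝ k x : ℝ) : ℂ))) * f x

/-- The tilted convolution `(f ⋆ g)(y) = ∫ f(x) conj(g(x - y)) dx`. -/
def tiltedConv (f g : E d → ℂ) (y : E d) : ℂ :=
  ∫ x, f x * conj (g (x - y))

/-- Measurable bounded functions with bounded support. -/
def IsTestFunction (f : E d → ℂ) : Prop :=
  Measurable f ∧ (∃ C : ℝ, ∀ x, ‖f x‖ ≤ C) ∧ HasCompactSupport f

/-- `m` is the Bartlett spectral measure of `Φ`, i.e. the Fourier transform of the positive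
semi-definite measure `β_Φ`: the (unique) locally finite measure with
`β_Φ(f ⋆ g) = ∫ f̂(k) conj(ĝ(k)) m(dk)` for all bounded `f`, `g` with bounded support. -/
structure IsBartlettSpectralMeasure (P : Measure Ω) (Φ : Kernel Ω (E d)) (γ : ℝ≥0)
    (m : Measure (E d)) : Prop where
  locallyFinite : IsLocallyFiniteMeasure m
  integrable : ∀ f g : E d → ℂ, IsTestFunction f → IsTestFunction g →
    Integrable (fun k => fourierHat f k * conj (fourierHat g k)) m
  spectral : ∀ f g : E d → ℂ, IsTestFunction f → IsTestFunction g →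
    covarianceIntegral P Φ γ (tiltedConv f g) =
      ∫ k, fourierHat f k * conj (fourierHat g k) ∂m

/-- `∞`-uniformity of a random measure of intensity `γ`: its Bartlett spectral measure vanishes on
an open ball `B_ε` with `ε > 0`. -/
def IsInftyUniform (P : Measure Ω) (Φ : Kernel Ω (E d)) (γ : ℝ≥0) : Prop :=
  ∃ m : Measure (E d), IsBartlettSpectralMeasure P Φ γ m ∧
    ∃ ε : ℝ, 0 < ε ∧ m (Metric.ball 0 ε) = 0

/-! ### Random transport kernels

A random probability kernel is a Markov kernel `K` from `Ω × ℝ^d` to `ℝ^d`. -/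

/-- Invariance of a transport kernel: `K(θ_z ω, x - z, B - z) = K(ω, x, B)`. -/
def IsInvariantKernel [AddAction (E d) Ω] (K : Kernel (Ω × E d) (E d)) : Prop :=
  ∀ (z : E d) (ω : Ω) (x : E d), K (z +ᵥ ω, x - z) = (K (ω, x)).map (fun y => y - z)

/-- The destination `(Kφ)(ω, B) = ∫ K(ω, x, B) φ(dx)` of a measure `φ` (a realization of the
source) under `K`. -/
def transport (K : Kernel (Ω × E d) (E d)) (ω : Ω) (φ : Measure (E d)) : Measure (E d) :=
  φ.bind fun x => K (ω, x)

/-- `K` does not depend on `ω`. -/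
def IsDeterministicKernel (K : Kernel (Ω × E d) (E d)) : Prop :=
  ∀ (ω ω' : Ω) (x : E d), K (ω, x) = K (ω', x)

/-- The components of the tensor `∫ x^{⊗q} μ(dx)`. -/
def momentTensor (q : ℕ) (μ : Measure (E d)) : (Fin q → Fin d) → ℝ :=
  fun j => ∫ x, ∏ i, x (j i) ∂μ

/-- `𝔼[∫ ‖x‖^p K_0(dx)]`, with the expectation taken under `P`. -/
def absMoment (P : Measure Ω) (p : ℝ) (K : Kernel (Ω × E d) (E d)) : ℝ≥0∞ :=
  ∫⁻ ω, ∫⁻ x, ‖x‖ₑ ^ p ∂(K (ω, 0)) ∂P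

/-- The tensor `∫ x^{⊗q} K_0(dx)` is deterministic, i.e. almost surely constant. -/
def HasDeterministicMoment (P : Measure Ω) (q : ℕ) (K : Kernel (Ω × E d) (E d)) : Prop :=
  ∃ c : (Fin q → Fin d) → ℝ, ∀ᵐ ω ∂P, momentTensor q (K (ω, 0)) = c

/-! ### Transport distances -/

/-- The distance `d_p(Φ, γ λ_d)`. -/
def dDist [AddAction (E d) Ω] (P : Measure Ω) (p : ℝ) (Φ : Kernel Ω (E d)) (γ : ℝ≥0) : ℝ≥0∞ :=
  sInf {r | ∃ K L : Kernel (Ω × E d) (E d),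
    IsMarkovKernel K ∧ IsMarkovKernel L ∧ IsInvariantKernel K ∧ IsInvariantKernel L ∧
    (∀ᵐ ω ∂P, Φ ω = γ • transport K ω volume) ∧
    (∀ᵐ ω ∂P, volume = transport L ω volume) ∧
    (∀ q : ℕ, 1 ≤ q → (q : ℝ) ≤ p / 2 - 1 →
      ∀ᵐ ω ∂P, momentTensor q (K (ω, 0)) = momentTensor q (L (ω, 0))) ∧
    r = absMoment P p K + absMoment P p L}

/-- The distance `d̃_p(Φ, γ λ_d)`. -/
def dTildeDist [AddAction (E d) Ω] (P : Measure Ω) (p : ℝ) (Φ : Kernel Ω (E d)) (γ : ℝ≥0) :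
    ℝ≥0∞ :=
  sInf {r | ∃ K : Kernel (Ω × E d) (E d),
    IsMarkovKernel K ∧ IsInvariantKernel K ∧
    (∀ᵐ ω ∂P, Φ ω = γ • transport K ω volume) ∧
    (∀ q : ℕ, 1 ≤ q → (q : ℝ) ≤ p / 2 - 1 → HasDeterministicMoment P q K) ∧
    r = absMoment P p K}

/-- The Palm probability measure
`P_0^Φ(A) = γ⁻¹ 𝔼[∫_{[0,1)^d} 1{θ_x ω ∈ A} Φ(ω, dx)]` of an invariant random measure with
intensity `γ > 0`. -/
def palm [AddAction (E d) Ω] (P : Measure Ω) (Φ : Kernel Ω (E d)) (γ : ℝ≥0) : Measure Ω :=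
  (γ : ℝ≥0∞)⁻¹ • P.bind fun ω => ((Φ ω).restrict (unitCube d)).map (fun x => x +ᵥ ω)

/-- The `p`-Wasserstein distance `W_p(Φ, Ψ)`, `1 ≤ p < ∞`, of invariant random measures of the
same intensity `γ > 0`. -/
def wassersteinDist [AddAction (E d) Ω] (P : Measure Ω) (p : ℝ) (γ : ℝ≥0)
    (Φ Ψ : Kernel Ω (E d)) : ℝ≥0∞ :=
  sInf {r | ∃ K : Kernel (Ω × E d) (E d),
    IsMarkovKernel K ∧ IsInvariantKernel K ∧
    (∀ᵐ ω ∂P, Ψ ω = transport K ω (Φ ω)) ∧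
    r = absMoment (palm P Φ γ) p K ^ (1 / p)}

/-- The deterministic measure `γ λ_d`, seen as a random measure. -/
def scaledLebesgue (Ω : Type*) [MeasurableSpace Ω] (d : ℕ) (γ : ℝ≥0) : Kernel Ω (E d) :=
  Kernel.const Ω (γ • (volume : Measure (E d)))

/-! ### The integrals defining `α_Φ` and the Palm measure are genuine -/

theorem measurableSet_unitCube : MeasurableSet (unitCube d) := by
  have h : unitCube d = ⋂ i, {x : E d | 0 ≤ x i ∧ x i < 1} := by
    ext x; simp [unitCube]
  rw [h]
  refine MeasurableSet.iInter fun i => ?_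
  have hi : Measurable fun x : E d => x i := by fun_prop
  exact (measurableSet_le measurable_const hi).inter (measurableSet_lt hi measurable_const)

theorem IsRandomMeasure.isSFiniteKernel {Φ : Kernel Ω (E d)} (h : IsRandomMeasure Φ) :
    IsSFiniteKernel Φ := by
  classical
  let B : ℕ → Set (E d) := disjointed fun n => Metric.ball 0 (n : ℝ)
  have hBm : ∀ n, MeasurableSet (B n) :=
    fun n => MeasurableSet.disjointed (fun n => measurableSet_ball) n
  have hBfin : ∀ n ω, Φ ω (B n) < ∞ := by
    intro n ω
    have := h ω
    exact (measure_mono (disjointed_subset _ n)).trans_lt measure_ball_lt_top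
  have hS : ∀ n k : ℕ, MeasurableSet {ω | ⌊(Φ ω (B n)).toReal⌋₊ = k} := by
    intro n k
    have : Measurable fun ω => ⌊(Φ ω (B n)).toReal⌋₊ :=
      Nat.measurable_floor.comp (Φ.measurable_coe (hBm n)).ennreal_toReal
    exact this (measurableSet_singleton k)
  let κ : ℕ × ℕ → Kernel Ω (E d) := fun z =>
    Kernel.piecewise (hS z.1 z.2) (Φ.restrict (hBm z.1)) 0
  have hκ : ∀ z, IsFiniteKernel (κ z) := by
    rintro ⟨n, k⟩
    refine ⟨⟨(k : ℝ≥0∞) + 1, by finiteness, fun ω => ?_⟩⟩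
    simp only [κ, Kernel.piecewise_apply]
    split_ifs with hω
    · rw [Kernel.restrict_apply, Measure.restrict_apply_univ]
      have h1 : (Φ ω (B n)).toReal < k + 1 := by
        have := Nat.lt_floor_add_one (Φ ω (B n)).toReal
        rw [show ⌊(Φ ω (B n)).toReal⌋₊ = k from hω] at this
        exact this
      have h2 := (ENNReal.ofReal_le_ofReal h1.le)
      rw [ENNReal.ofReal_toReal (hBfin n ω).ne] at h2
      refine h2.trans (le_of_eq ?_)
      rw [ENNReal.ofReal_add (by positivity) (by positivity)]
      simp
    · simp
  have hsum : Φ = Kernel.sum κ := by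
    ext ω s hs
    rw [Kernel.sum_apply, Measure.sum_apply _ hs, ENNReal.tsum_prod']
    have hin : ∀ n, ∑' k, κ (n, k) ω s = Φ ω (s ∩ B n) := by
      intro n
      rw [tsum_eq_single ⌊(Φ ω (B n)).toReal⌋₊]
      · simp only [κ, Kernel.piecewise_apply]
        rw [if_pos (by simp), Kernel.restrict_apply, Measure.restrict_apply hs]
      · intro k hk
        simp only [κ, Kernel.piecewise_apply]
        rw [if_neg (by simpa using hk.symm)]
        simp
    simp_rw [hin]
    rw [← measure_iUnion]
    · rw [← Set.inter_iUnion, iUnion_disjointed, Metric.iUnion_ball_nat, Set.inter_univ]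
    · intro i j hij
      exact (disjoint_disjointed _ hij).mono Set.inter_subset_right Set.inter_subset_right
    · exact fun n => hs.inter (hBm n)
  rw [hsum]
  infer_instance

theorem reducedSecondMoment_apply (P : Measure Ω) {Φ : Kernel Ω (E d)} (h : IsRandomMeasure Φ)
    {B : Set (E d)} (hB : MeasurableSet B) :
    reducedSecondMoment P Φ B =
      ∫⁻ ω, ∫⁻ x in unitCube d, Φ ω {y | x - y ∈ B} ∂(Φ ω) ∂P := by
  have := h.isSFiniteKernel
  have hsub : Measurable fun z : E d × E d => z.1 - z.2 := by fun_prop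
  have hm : Measurable fun ω =>
      (((Φ ω).restrict (unitCube d)).prod (Φ ω)).map (fun z : E d × E d => z.1 - z.2) := by
    have := (((Φ.restrict (measurableSet_unitCube (d := d))) ×ₖ Φ).map
      (fun z : E d × E d => z.1 - z.2)).measurable
    convert this using 2 with ω
    rw [Kernel.map_apply _ hsub, Kernel.prod_apply, Kernel.restrict_apply]
  rw [reducedSecondMoment, Measure.bind_apply hB hm.aemeasurable]
  refine lintegral_congr fun ω => ?_
  have hs : SFinite (Φ ω) := inferInstance
  rw [Measure.map_apply hsub hB, Measure.prod_apply (hsub hB)]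
  rfl

theorem palm_apply [AddAction (E d) Ω] [MeasurableVAdd₂ (E d) Ω] (P : Measure Ω)
    {Φ : Kernel Ω (E d)} (h : IsRandomMeasure Φ) (γ : ℝ≥0) {A : Set Ω} (hA : MeasurableSet A) :
    palm P Φ γ A =
      (γ : ℝ≥0∞)⁻¹ * ∫⁻ ω, (Φ ω) ({x | x +ᵥ ω ∈ A} ∩ unitCube d) ∂P := by
  have := h.isSFiniteKernel
  have hv : Measurable fun z : Ω × E d => z.2 +ᵥ z.1 := measurable_snd.vadd measurable_fst
  have hω : ∀ ω : Ω, Measurable fun x : E d => x +ᵥ ω := fun ω => hv.comp measurable_prodMk_left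
  have hm : Measurable fun ω => ((Φ ω).restrict (unitCube d)).map (fun x => x +ᵥ ω) := by
    have := ((Kernel.id ×ₖ (Φ.restrict (measurableSet_unitCube (d := d)))).map
      (fun z : Ω × E d => z.2 +ᵥ z.1)).measurable
    convert this using 2 with ω
    rw [Kernel.map_apply _ hv, Kernel.prod_apply, Kernel.restrict_apply, Kernel.id_apply,
      Measure.dirac_prod, Measure.map_map hv measurable_prodMk_left]
    rfl
  rw [palm, Measure.smul_apply, Measure.bind_apply hA hm.aemeasurable, smul_eq_mul]
  congr 1
  refine lintegral_congr fun ω => ?_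
  rw [Measure.map_apply (hω ω) hA, Measure.restrict_apply (hω ω hA)]
  rfl

end Probability

end StealthyTransport

end

/-! The gap in the spectrum makes suitable linear statistics of `Ψ` almost surely constant, and
these statistics normalise an explicit transport kernel.

Choose a rapidly decreasing probability density `φ` whose Fourier transform lives strictly inside
the ball `B_ε` on which the Bartlett measure vanishes (`exists_density_fourierHat_eq_zero`).
Multiplication by coordinates becomes differentiation on the Fourier side, so every monomial times
`φ` has its spectrum in the same ball. The variance of `∫ f dΨ` is the integral of `|f̂|²` against
the Bartlett measure. It therefore vanishes for each such `f`, and `∫ f dΨ = γ ∫ f` almost surely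
(`ae_integral_eq_of_fourierHat_eq_zero`). The spectral identity is only given for bounded support,
so this needs a truncation argument.

Consequently `∫ φ(y - x) Ψ(dy) = γ` for almost every `x`, and `K(ω, x, dy) = γ⁻¹ φ(y - x) Ψ(ω, dy)`
is a probability kernel. Since `∫ φ(y - x) dx = 1`, it sends `λ_d` to `γ⁻¹ Ψ`. The moments of `K_0`
are `γ⁻¹` times linear statistics of monomials times `φ`, so they equal the moments of `μ = φ λ_d`.
Translation by a `μ`-distributed vector serves as `L`. Translation by the reflected law sends `Ψ` to
the measure with density `∫ φ(y - x) Ψ(dy) = γ`, which gives the transport in the other direction.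
All this is collected in `exists_invariant_transport`.

The comparison of `d_p` with `d̃_p` is independent of the gap: the averaged law of `K_0` defines a
deterministic translation kernel with the same cost and, where the moments of `K_0` are
deterministic, the same moments. -/

namespace StealthyTransport

/-! ### Densities with Fourier transform supported in a small ball -/

section FourierSupport

open scoped FourierTransform SchwartzMap LineDeriv Convolution

variable {d : ℕ}

theorem fourierHat_eq_fourier (f : E d → ℂ) (k : E d) :
    fourierHat f k = 𝓕 f ((2 * Real.pi)⁻¹ • k) := by
  rw [Real.fourier_eq']
  refine integral_congr_ae (.of_forall fun x => ?_)
  simp only [smul_eq_mul]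
  congr 2
  rw [inner_smul_right, real_inner_comm]
  have : (Real.pi : ℂ) ≠ 0 := by exact_mod_cast Real.pi_ne_zero
  push_cast
  field_simp

/-- Up to a nonzero constant, a coordinate factor turns into a directional derivative of the Fourier
transform, and differentiation does not enlarge the support. Induction on the degree adds one
coordinate at a time. -/
theorem exists_schwartzMap_monomial_mul (g : 𝓢(E d, ℂ)) :
    ∀ (q : ℕ) (j : Fin q → Fin d), ∃ h : 𝓢(E d, ℂ),
      (∀ x, h x = ((∏ i, x (j i) : ℝ) : ℂ) * g x) ∧
        tsupport (𝓕 h : 𝓢(E d, ℂ)) ⊆ tsupport (𝓕 g : 𝓢(E d, ℂ)) := by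
  intro q
  induction q with
  | zero => exact fun j => ⟨g, by simp, subset_rfl⟩
  | succ q ih =>
    intro j
    obtain ⟨h, hh, hs⟩ := ih (fun i => j i.succ)
    let e : E d := EuclideanSpace.single (j 0) 1
    have ht : (inner ℝ · e : E d → ℝ).HasTemperateGrowth := by fun_prop
    refine ⟨SchwartzMap.smulLeftCLM ℂ (inner ℝ · e) h, fun x => ?_, ?_⟩
    · rw [SchwartzMap.smulLeftCLM_apply_apply ht, hh, Fin.prod_univ_succ]
      have he : inner ℝ x e = x (j 0) := by simp [e, EuclideanSpace.inner_single_right]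
      rw [he, Complex.real_smul]
      push_cast
      ring
    · have hc : (-(2 * Real.pi * Complex.I)) ≠ 0 := by simp [Real.pi_ne_zero]
      have key : 𝓕 (SchwartzMap.smulLeftCLM ℂ (inner ℝ · e) h) =
          (-(2 * Real.pi * Complex.I))⁻¹ • (∂_{e} (𝓕 h) : 𝓢(E d, ℂ)) := by
        rw [SchwartzMap.lineDerivOp_fourier_eq, FourierTransform.fourier_smul,
          inv_smul_smul₀ hc]
      rw [key]
      refine (closure_mono ?_).trans ((SchwartzMap.tsupport_lineDerivOp_subset e (𝓕 h)).trans hs)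
      intro x hx
      simp only [Function.mem_support, _root_.smul_apply] at hx ⊢
      exact fun h0 => hx (by rw [h0, smul_zero])

/-- A Schwartz function with nonnegative values, positive at the origin, whose Fourier transform is
supported in a prescribed ball. -/
theorem exists_schwartzMap_nonneg_fourier_tsupport {δ : ℝ} (hδ : 0 < δ) :
    ∃ (g : 𝓢(E d, ℂ)) (φ : E d → ℝ), (∀ x, g x = φ x) ∧ (∀ x, 0 ≤ φ x) ∧ 0 < φ 0 ∧
      tsupport (𝓕 g : 𝓢(E d, ℂ)) ⊆ Metric.closedBall 0 δ := by
  -- The outer radius is `δ / 2` because the self-convolution doubles the support.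
  let b : ContDiffBump (0 : E d) := ⟨δ / 4, δ / 2, by positivity, by linarith⟩
  have hbs : ContDiff ℝ (⊤ : ℕ∞) fun x => (b x : ℂ) := Complex.ofRealCLM.contDiff.comp b.contDiff
  have hbc : HasCompactSupport fun x => (b x : ℂ) :=
    b.hasCompactSupport.comp_left (g := fun r : ℝ => (r : ℂ)) rfl
  let s : 𝓢(E d, ℂ) := hbc.toSchwartzMap hbs
  have hs : ∀ x, s x = (b x : ℂ) := fun x => rfl
  -- The bump is even and real, so its Fourier transform is real; the square of that transform is
  -- then nonnegative.
  have hreal : ∀ x, ((𝓕 s x).re : ℂ) = 𝓕 s x := by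
    intro x
    rw [← Complex.conj_eq_iff_re]
    rw [SchwartzMap.fourier_coe, Real.fourier_eq', ← integral_conj,
      ← integral_neg_eq_self]
    refine integral_congr_ae (.of_forall fun y => ?_)
    simp only [smul_eq_mul, map_mul, hs, b.neg, Complex.conj_ofReal, ← Complex.exp_conj,
      Complex.conj_I, inner_neg_left]
    congr 2
    push_cast
    ring
  let ρ := SchwartzMap.convolution (ContinuousLinearMap.mul ℂ ℂ) s s
  have hρ : ∀ x, 𝓕 ρ x = 𝓕 s x * 𝓕 s x := by
    intro x
    rw [SchwartzMap.fourier_convolution]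
    rfl
  refine ⟨𝓕 ρ, fun x => (𝓕 s x).re ^ 2, fun x => ?_, fun x => sq_nonneg _, ?_, ?_⟩
  · rw [hρ, ← hreal x]; push_cast; ring
  · have : 𝓕 s 0 = ((∫ x, b x : ℝ) : ℂ) := by
      rw [SchwartzMap.fourier_coe, Real.fourier_eq', ← integral_complex_ofReal]
      simp [hs]
    beta_reduce
    rw [this]
    have := b.integral_pos (μ := (volume : Measure (E d)))
    simp only [Complex.ofReal_re]
    positivity
  · refine closure_minimal (fun x hx => ?_) Metric.isClosed_closedBall
    by_contra hxn
    refine hx ?_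
    -- By Fourier inversion, the transform of the chosen function is the reflected self-convolution,
    -- whose support is explicit.
    have h1 : 𝓕 (𝓕 ρ) x = ρ (-x) := by
      have := congrArg (fun h : 𝓢(E d, ℂ) => h (-x))
        (FourierTransform.fourierInv_fourier_eq (F := 𝓢(E d, ℂ)) ρ)
      simp only [SchwartzMap.fourierInv_apply_eq] at this
      simpa using this
    rw [h1, SchwartzMap.convolution_apply, convolution]
    refine integral_eq_zero_of_ae (.of_forall fun t => ?_)
    simp only [ContinuousLinearMap.mul_apply', hs, Pi.zero_apply, mul_eq_zero,
      Complex.ofReal_eq_zero]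
    by_contra! hcon
    have e1 : t ∈ Metric.ball (0 : E d) (δ / 2) := by
      rw [← b.support_eq]; exact hcon.1
    have e2 : -x - t ∈ Metric.ball (0 : E d) (δ / 2) := by
      rw [← b.support_eq]; exact hcon.2
    rw [mem_ball_zero_iff] at e1 e2
    have : ‖x‖ ≤ ‖t‖ + ‖-x - t‖ := by
      have : x = -(t + (-x - t)) := by abel
      calc ‖x‖ = ‖t + (-x - t)‖ := by rw [← norm_neg (t + _), ← this]
        _ ≤ _ := norm_add_le _ _
    rw [mem_closedBall_zero_iff] at hxn
    linarith

theorem SchwartzMap.exists_norm_le_one_add_norm_rpow (g : 𝓢(E d, ℂ)) (n : ℕ) :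
    ∃ C : ℝ, ∀ x, ‖g x‖ ≤ C * (1 + ‖x‖) ^ (-(n : ℝ)) := by
  refine ⟨2 ^ n * ((Finset.Iic (n, 0)).sup (fun m => SchwartzMap.seminorm ℝ m.1 m.2)) g,
    fun x => ?_⟩
  have h := SchwartzMap.one_add_le_sup_seminorm_apply (𝕜 := ℝ) (m := (n, 0)) le_rfl le_rfl g x
  have hp : 0 < 1 + ‖x‖ := by positivity
  rw [Real.rpow_neg hp.le, Real.rpow_natCast, ← div_eq_mul_inv, le_div_iff₀ (by positivity),
    mul_comm]
  simpa using h

/-- A rapidly decreasing probability density all of whose moments have a Fourier transform that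
vanishes away from a prescribed ball. -/
theorem exists_density_fourierHat_eq_zero (d : ℕ) {ε : ℝ} (hε : 0 < ε) :
    ∃ φ : E d → ℝ, Continuous φ ∧ (∀ x, 0 ≤ φ x) ∧ ∫ x, φ x = 1 ∧
      (∀ n : ℕ, ∃ C : ℝ, ∀ x, |φ x| ≤ C * (1 + ‖x‖) ^ (-(n : ℝ))) ∧
      ∀ (q : ℕ) (j : Fin q → Fin d) (k : E d), ε ≤ ‖k‖ →
        fourierHat (fun x => (((∏ i, x (j i)) * φ x : ℝ) : ℂ)) k = 0 := by
  have hπ := Real.pi_pos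
  -- The factor `(2π)⁻¹` converts angular frequency to the normalisation of `𝓕`. The halved radius
  -- puts the closed supporting ball strictly inside `‖k‖ < ε`.
  obtain ⟨g, φ, hg, hφ, hφ0, hs⟩ :=
    exists_schwartzMap_nonneg_fourier_tsupport (d := d)
      (δ := (2 * Real.pi)⁻¹ * (ε / 2)) (by positivity)
  have hφre : φ = fun x => (g x).re := by ext x; simp [hg]
  have hcont : Continuous φ := by rw [hφre]; exact Complex.continuous_re.comp g.continuous
  have hint : Integrable φ := by rw [hφre]; exact g.integrable.re
  have hpos : 0 < ∫ x, φ x := by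
    rw [integral_pos_iff_support_of_nonneg hφ hint]
    exact hcont.isOpen_support.measure_pos _ ⟨0, hφ0.ne'⟩
  set c := ∫ x, φ x with hc
  refine ⟨fun x => c⁻¹ * φ x, by fun_prop, fun x => by have := hφ x; positivity, ?_, fun n => ?_,
    fun q j k hk => ?_⟩
  · rw [integral_const_mul, ← hc, inv_mul_cancel₀ hpos.ne']
  · obtain ⟨C, hC⟩ := SchwartzMap.exists_norm_le_one_add_norm_rpow g n
    refine ⟨c⁻¹ * C, fun x => ?_⟩
    have := hC x
    rw [hg, Complex.norm_real, Real.norm_eq_abs] at this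
    rw [abs_mul, abs_of_pos (by positivity : 0 < c⁻¹), mul_assoc]
    gcongr
  · obtain ⟨h, hh, hhs⟩ := exists_schwartzMap_monomial_mul g q j
    have e : (fun x => (((∏ i, x (j i)) * (c⁻¹ * φ x) : ℝ) : ℂ)) = ⇑(((c⁻¹ : ℝ) : ℂ) • h) := by
      ext x
      rw [_root_.smul_apply, hh, hg]
      push_cast
      simp only [smul_eq_mul]
      ring
    rw [fourierHat_eq_fourier, e, ← SchwartzMap.fourier_coe, FourierTransform.fourier_smul,
      _root_.smul_apply]
    rw [image_eq_zero_of_notMem_tsupport (f := ⇑(𝓕 h : 𝓢(E d, ℂ))) (fun hmem => ?_), smul_zero]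
    have := hs (hhs hmem)
    rw [mem_closedBall_zero_iff, norm_smul, norm_inv, Real.norm_eq_abs,
      abs_of_pos (by positivity : 0 < 2 * Real.pi)] at this
    have := le_of_mul_le_mul_left this (by positivity)
    linarith

end FourierSupport

/-! ### Second moment measure and its disintegration along the diagonal -/

section SecondMoment

variable {d : ℕ} {Ω : Type*} [MeasurableSpace Ω]

theorem volume_unitCube (d : ℕ) : volume (unitCube d) = 1 := by
  have h : unitCube d = (WithLp.ofLp : E d → Fin d → ℝ) ⁻¹'
      (Set.univ.pi fun _ => Set.Ico (0 : ℝ) 1) := by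
    ext x
    simp [unitCube]
  rw [h, (PiLp.volume_preserving_ofLp (Fin d)).measure_preimage
    (MeasurableSet.univ_pi fun _ => measurableSet_Ico).nullMeasurableSet, Real.volume_pi_Ico]
  simp

theorem integral_measure_comp {P : Measure Ω} [SFinite P] {α : Type*} [MeasurableSpace α]
    {κ : Kernel Ω α} [IsSFiniteKernel κ] {G : Type*} [NormedAddCommGroup G] [NormedSpace ℝ G]
    {f : α → G} (hf : Integrable f (κ ∘ₘ P)) :
    ∫ z, f z ∂(κ ∘ₘ P) = ∫ ω, ∫ z, f z ∂(κ ω) ∂P := by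
  rw [Measure.comp_eq_comp_const_apply] at hf ⊢
  rw [Kernel.integral_comp hf, Kernel.const_apply]

/-- The second moment measure `𝔼[Φ ⊗ Φ]`. -/
noncomputable def secondMoment (P : Measure Ω) (Φ : Kernel Ω (E d)) : Measure (E d × E d) :=
  (Φ ×ₖ Φ) ∘ₘ P

variable {P : Measure Ω} {Ψ : Kernel Ω (E d)}

instance [SFinite P] [IsSFiniteKernel Ψ] : SFinite (secondMoment P Ψ) := by
  unfold secondMoment; infer_instance

theorem lintegral_secondMoment [IsSFiniteKernel Ψ] {H : E d × E d → ℝ≥0∞} (hH : Measurable H) :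
    ∫⁻ z, H z ∂(secondMoment P Ψ) = ∫⁻ ω, ∫⁻ x, ∫⁻ y, H (x, y) ∂(Ψ ω) ∂(Ψ ω) ∂P := by
  rw [secondMoment, Measure.lintegral_bind (Kernel.aemeasurable _) hH.aemeasurable]
  refine lintegral_congr fun ω => ?_
  rw [Kernel.prod_apply, lintegral_prod _ hH.aemeasurable]

theorem lintegral_secondMoment_mul [IsSFiniteKernel Ψ] {f : E d → ℝ≥0∞} (hf : Measurable f) :
    ∫⁻ z, f z.1 * f z.2 ∂(secondMoment P Ψ) = ∫⁻ ω, (∫⁻ x, f x ∂(Ψ ω)) ^ 2 ∂P := by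
  rw [lintegral_secondMoment (H := fun z => f z.1 * f z.2) (by fun_prop)]
  refine lintegral_congr fun ω => ?_
  simp_rw [lintegral_const_mul _ hf]
  rw [lintegral_mul_const _ hf, sq]

theorem reducedSecondMoment_eq_map (hΨ : IsRandomMeasure Ψ) :
    reducedSecondMoment P Ψ =
      ((secondMoment P Ψ).restrict (unitCube d ×ˢ Set.univ)).map fun z => z.1 - z.2 := by
  have := hΨ.isSFiniteKernel
  have hsub : Measurable fun z : E d × E d => z.1 - z.2 := by fun_prop
  have hC := measurableSet_unitCube (d := d)
  ext B hB
  have hm : MeasurableSet ((fun z : E d × E d => z.1 - z.2) ⁻¹' B ∩ unitCube d ×ˢ Set.univ) :=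
    (hsub hB).inter (hC.prod .univ)
  rw [reducedSecondMoment_apply P hΨ hB, Measure.map_apply hsub hB,
    Measure.restrict_apply (hsub hB), ← lintegral_indicator_one hm,
    lintegral_secondMoment (measurable_one.indicator hm)]
  refine lintegral_congr fun ω => ?_
  rw [← lintegral_indicator hC]
  refine lintegral_congr fun x => ?_
  by_cases hx : x ∈ unitCube d
  · rw [Set.indicator_of_mem hx, ← lintegral_indicator_one]
    · refine lintegral_congr fun y => ?_
      by_cases hxy : x - y ∈ B <;> simp [hx, hxy]
    · exact (hsub.comp measurable_prodMk_left) hB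
  · rw [Set.indicator_of_notMem hx]
    simp [hx]

theorem integral_secondMoment_mul_conj [SFinite P] [IsSFiniteKernel Ψ] {F : E d → ℂ}
    (hint : Integrable (fun z : E d × E d => F z.1 * conj (F z.2)) (secondMoment P Ψ)) :
    ∫ z, F z.1 * conj (F z.2) ∂(secondMoment P Ψ) =
      ∫ ω, (∫ x, F x ∂(Ψ ω)) * conj (∫ x, F x ∂(Ψ ω)) ∂P := by
  unfold secondMoment at hint ⊢
  rw [integral_measure_comp hint]
  refine integral_congr_ae (.of_forall fun ω => ?_)
  simp only
  rw [Kernel.prod_apply, integral_prod_mul (fun x => F x) (fun y => conj (F y)), integral_conj]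

section Invariant

variable [AddAction (E d) Ω] [MeasurableVAdd₂ (E d) Ω] [VAddInvariantMeasure (E d) Ω P]

theorem lintegral_vadd_eq_self {f : Ω → ℝ≥0∞} (hf : Measurable f) (x : E d) :
    ∫⁻ ω, f (x +ᵥ ω) ∂P = ∫⁻ ω, f ω ∂P :=
  (measurePreserving_vadd x P).lintegral_comp hf

theorem ae_vadd {p : Ω → Prop} (h : ∀ᵐ ω ∂P, p ω) (x : E d) : ∀ᵐ ω ∂P, p (x +ᵥ ω) :=
  (measurePreserving_vadd x P).quasiMeasurePreserving.ae h

/-- Stationarity of `P` turns the pathwise covariance of `Ψ` into invariance under diagonal shifts.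
-/
theorem measurePreserving_secondMoment [IsSFiniteKernel Ψ] (hinv : IsInvariant Ψ) (w : E d) :
    MeasurePreserving (fun z : E d × E d => (z.1 + w, z.2 + w))
      (secondMoment P Ψ) (secondMoment P Ψ) := by
  have hs : Measurable fun z : E d × E d => (z.1 + w, z.2 + w) := by fun_prop
  refine ⟨hs, ?_⟩
  have key : ∀ ω, (Ψ ×ₖ Ψ) (-w +ᵥ ω) = ((Ψ ×ₖ Ψ) ω).map fun z => (z.1 + w, z.2 + w) := by
    intro ω
    have ha : Measurable fun y : E d => y - -w := by fun_prop
    rw [Kernel.prod_apply, Kernel.prod_apply, hinv, Measure.map_prod_map _ _ ha ha]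
    congr 1
    ext z <;> simp
  ext B hB
  rw [Measure.map_apply hs hB, secondMoment, Measure.bind_apply (hs hB) (Kernel.aemeasurable _),
    Measure.bind_apply hB (Kernel.aemeasurable _),
    ← lintegral_vadd_eq_self ((Ψ ×ₖ Ψ).measurable_coe hB) (-w)]
  refine lintegral_congr fun ω => ?_
  rw [key, Measure.map_apply hs hB]

variable [SFinite P]

/-- A mass-transport argument: insert `1 = ∫ 1{z.1 - w ∈ [0,1)^d} dw`, exchange the integrals, and
move the shift by `w` onto `H` using diagonal invariance. -/
theorem lintegral_secondMoment_eq_unitCube [IsSFiniteKernel Ψ] (hinv : IsInvariant Ψ)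
    {H : E d × E d → ℝ≥0∞} (hH : Measurable H) :
    ∫⁻ z, H z ∂(secondMoment P Ψ) =
      ∫⁻ z in unitCube d ×ˢ Set.univ, (∫⁻ w, H (z.1 + w, z.2 + w)) ∂(secondMoment P Ψ) := by
  have hC := measurableSet_unitCube (d := d)
  let c : E d → ℝ≥0∞ := (unitCube d).indicator 1
  have hc : Measurable c := measurable_one.indicator hC
  have e1 : ∀ w : E d, ∫⁻ z, c z.1 * H (z.1 + w, z.2 + w) ∂(secondMoment P Ψ) =
      ∫⁻ z, c (z.1 - w) * H z ∂(secondMoment P Ψ) := by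
    intro w
    rw [← (measurePreserving_secondMoment hinv w).lintegral_comp
      (f := fun z => c (z.1 - w) * H z) (by fun_prop)]
    simp
  calc ∫⁻ z, H z ∂(secondMoment P Ψ)
      = ∫⁻ z, (∫⁻ w, c (z.1 - w) * H z) ∂(secondMoment P Ψ) := by
        refine lintegral_congr fun z => ?_
        rw [lintegral_mul_const _ (by fun_prop), lintegral_sub_left_eq_self c z.1,
          lintegral_indicator_one hC, volume_unitCube, one_mul]
    _ = ∫⁻ w, ∫⁻ z, c z.1 * H (z.1 + w, z.2 + w) ∂(secondMoment P Ψ) := by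
        rw [lintegral_lintegral_swap (by fun_prop)]
        simp_rw [e1]
    _ = ∫⁻ z, (∫⁻ w, c z.1 * H (z.1 + w, z.2 + w)) ∂(secondMoment P Ψ) := by
        rw [lintegral_lintegral_swap (by fun_prop)]
    _ = _ := by
        rw [← lintegral_indicator (hC.prod .univ)]
        refine lintegral_congr fun z => ?_
        rw [lintegral_const_mul _ (by fun_prop)]
        by_cases hz : z.1 ∈ unitCube d <;> simp [c, hz]

/-- The same disintegration as an identity of measures, in which form it also applies to
complex-valued Bochner integrals. -/
theorem secondMoment_eq_map [IsSFiniteKernel Ψ] (hinv : IsInvariant Ψ) :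
    secondMoment P Ψ =
      (((secondMoment P Ψ).restrict (unitCube d ×ˢ Set.univ)).prod volume).map
        fun p : (E d × E d) × E d => (p.1.1 + p.2, p.1.2 + p.2) := by
  refine Measure.ext_of_lintegral _ fun H hH => ?_
  rw [lintegral_map hH (by fun_prop), lintegral_prod _ (by fun_prop),
    lintegral_secondMoment_eq_unitCube hinv hH]

/-- Integrating `F ⊗ F̄` over the diagonal orbit of `z` gives the tilted convolution at `z.1 - z.2`.
This links the definition through `α_Φ` to second moments of linear statistics. -/
theorem integral_tiltedConv_reducedSecondMoment (hΨ : IsRandomMeasure Ψ) (hinv : IsInvariant Ψ)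
    {F : E d → ℂ} (hF : Measurable F)
    (hint : Integrable (fun z : E d × E d => F z.1 * conj (F z.2)) (secondMoment P Ψ)) :
    ∫ x, tiltedConv F F x ∂(reducedSecondMoment P Ψ) =
      ∫ z, F z.1 * conj (F z.2) ∂(secondMoment P Ψ) := by
  have := hΨ.isSFiniteKernel
  have hconv : StronglyMeasurable (tiltedConv F F) := by
    have : Measurable fun p : E d × E d => F p.2 * conj (F (p.2 - p.1)) := by
      have h2 : Measurable fun p : E d × E d => F (p.2 - p.1) := by fun_prop
      exact (hF.comp measurable_snd).mul (Complex.continuous_conj.measurable.comp h2)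
    exact this.stronglyMeasurable.integral_prod_right (ν := (volume : Measure (E d)))
  have hs : Measurable fun p : (E d × E d) × E d => (p.1.1 + p.2, p.1.2 + p.2) := by fun_prop
  have hint' := hint
  rw [secondMoment_eq_map hinv] at hint'
  rw [integrable_map_measure hint'.1 hs.aemeasurable] at hint'
  conv_rhs => rw [secondMoment_eq_map hinv]
  rw [integral_map hs.aemeasurable (by rw [← secondMoment_eq_map hinv]; exact hint.1)]
  rw [integral_prod (fun p : (E d × E d) × E d => F (p.1.1 + p.2) * conj (F (p.1.2 + p.2))) hint',
    reducedSecondMoment_eq_map hΨ,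
    integral_map (by fun_prop) hconv.aestronglyMeasurable]
  refine integral_congr_ae (.of_forall fun z => ?_)
  simp only [tiltedConv]
  rw [← integral_add_left_eq_self _ z.1]
  refine integral_congr_ae (.of_forall fun w => ?_)
  simp only
  congr 3
  abel

end Invariant

end SecondMoment

/-! ### Square integrability of linear statistics -/

section LinearStatistics

variable {d : ℕ} {Ω : Type*} [MeasurableSpace Ω]

/-- Measurable real functions decreasing at infinity at least as fast as `‖x‖ ^ (-(d + 1))`. -/
noncomputable def HasIntegrableDecay (f : E d → ℝ) : Prop :=
  Measurable f ∧ ∃ C : ℝ, ∀ x, |f x| ≤ C * (1 + ‖x‖) ^ (-((d + 1 : ℕ) : ℝ))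

theorem integrable_one_add_norm_rpow (d : ℕ) :
    Integrable fun x : E d => (1 + ‖x‖) ^ (-((d + 1 : ℕ) : ℝ)) := by
  refine integrable_one_add_norm ?_
  rw [finrank_euclideanSpace_fin]
  push_cast
  linarith

theorem HasIntegrableDecay.integrable {f : E d → ℝ} (hf : HasIntegrableDecay f) :
    Integrable f := by
  obtain ⟨hm, C, hC⟩ := hf
  exact ((integrable_one_add_norm_rpow d).const_mul C).mono' hm.aestronglyMeasurable
    (.of_forall hC)

theorem HasIntegrableDecay.indicator {f : E d → ℝ} (hf : HasIntegrableDecay f) {s : Set (E d)}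
    (hs : MeasurableSet s) : HasIntegrableDecay (s.indicator f) := by
  obtain ⟨hm, C, hC⟩ := hf
  refine ⟨hm.indicator hs, C, fun x => le_trans ?_ (hC x)⟩
  exact norm_indicator_le_norm_self f x

theorem HasIntegrableDecay.isTestFunction {f : E d → ℝ} (hf : HasIntegrableDecay f)
    {s : Set (E d)} (hs : MeasurableSet s) {R : ℝ} (hR : s ⊆ Metric.ball 0 R) :
    IsTestFunction fun x => ((s.indicator f x : ℝ) : ℂ) := by
  refine ⟨Complex.measurable_ofReal.comp (hf.1.indicator hs), ?_, ?_⟩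
  · obtain ⟨-, C, hC⟩ := hf.indicator hs
    refine ⟨|C|, fun x => ?_⟩
    rw [Complex.norm_real, Real.norm_eq_abs]
    refine (hC x).trans ?_
    have h1 : (1 + ‖x‖) ^ (-((d + 1 : ℕ) : ℝ)) ≤ 1 :=
      Real.rpow_le_one_of_one_le_of_nonpos (by linarith [norm_nonneg x])
        (neg_nonpos.2 (Nat.cast_nonneg _))
    have h0 : 0 ≤ (1 + ‖x‖) ^ (-((d + 1 : ℕ) : ℝ)) := by positivity
    calc C * (1 + ‖x‖) ^ (-((d + 1 : ℕ) : ℝ)) ≤ |C| * (1 + ‖x‖) ^ (-((d + 1 : ℕ) : ℝ)) := by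
          gcongr; exact le_abs_self C
      _ ≤ |C| * 1 := by gcongr
      _ = |C| := mul_one _
  · refine HasCompactSupport.intro (isCompact_closedBall (0 : E d) R) fun x hx => ?_
    have : x ∉ s := fun h => hx (Metric.ball_subset_closedBall (hR h))
    simp [this]

/-- Cauchy–Schwarz with weight `g`, from integrating `2ab ≤ a² + b²` over the product; in this form
no finiteness is needed. -/
theorem lintegral_mul_sq_le {α : Type*} [MeasurableSpace α] {μ : Measure α}
    {g u : α → ℝ≥0∞} (hg : Measurable g) (hu : Measurable u) :
    (∫⁻ a, g a * u a ∂μ) ^ 2 ≤ (∫⁻ a, g a ∂μ) * ∫⁻ a, g a * u a ^ 2 ∂μ := by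
  have h2 : ∀ a b : ℝ≥0∞, 2 * (a * b) ≤ a ^ 2 + b ^ 2 := fun a b => by
    wlog hab : a ≤ b generalizing a b
    · rw [mul_comm a, add_comm]
      exact this b a (le_of_not_ge hab)
    obtain ⟨c, rfl⟩ := exists_add_of_le hab
    calc 2 * (a * (a + c)) ≤ 2 * (a * (a + c)) + c ^ 2 := le_self_add
      _ = a ^ 2 + (a + c) ^ 2 := by ring
  have key : 2 * (∫⁻ a, g a * u a ∂μ) ^ 2 ≤ 2 * ((∫⁻ a, g a ∂μ) * ∫⁻ a, g a * u a ^ 2 ∂μ) := by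
    have hgu : Measurable fun a => g a * u a := hg.mul hu
    have hgu2 : Measurable fun a => g a * u a ^ 2 := hg.mul (hu.pow_const 2)
    calc 2 * (∫⁻ a, g a * u a ∂μ) ^ 2
        = ∫⁻ a, (∫⁻ b, 2 * ((g a * u a) * (g b * u b)) ∂μ) ∂μ := by
          simp_rw [lintegral_const_mul _ ((hgu.const_mul _)), lintegral_const_mul _ hgu]
          rw [lintegral_const_mul _ (hgu.mul_const _), lintegral_mul_const _ hgu, sq]
      _ ≤ ∫⁻ a, (∫⁻ b, (g a * u a ^ 2) * g b + g a * (g b * u b ^ 2) ∂μ) ∂μ := by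
          refine lintegral_mono fun a => lintegral_mono fun b => ?_
          calc 2 * ((g a * u a) * (g b * u b)) = g a * g b * (2 * (u a * u b)) := by ring
            _ ≤ g a * g b * (u a ^ 2 + u b ^ 2) := by gcongr; exact h2 _ _
            _ = _ := by ring
      _ = 2 * ((∫⁻ a, g a ∂μ) * ∫⁻ a, g a * u a ^ 2 ∂μ) := by
          simp_rw [lintegral_add_left (hg.const_mul _), lintegral_const_mul _ hg,
            lintegral_const_mul _ hgu2]
          rw [lintegral_add_left (hgu2.mul_const _), lintegral_mul_const _ hgu2,
            lintegral_mul_const _ hg]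
          ring
  exact (ENNReal.mul_le_mul_iff_right (by simp) (by simp)).1 key

variable {P : Measure Ω} {Ψ : Kernel Ω (E d)} {γ : ℝ≥0}

theorem HasIntensity.lintegral (hγ : HasIntensity P Ψ γ) {f : E d → ℝ≥0∞} (hf : Measurable f) :
    ∫⁻ ω, ∫⁻ x, f x ∂(Ψ ω) ∂P = γ * ∫⁻ x, f x := by
  rw [← Measure.lintegral_bind (Kernel.aemeasurable _) hf.aemeasurable, hγ,
    lintegral_smul_measure]
  rfl

theorem HasIntensity.integrable_comp (hγ : HasIntensity P Ψ γ) {f : E d → ℝ}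
    (hf : Integrable f) : Integrable f (Ψ ∘ₘ P) := by
  have : Ψ ∘ₘ P = γ • volume := hγ
  rw [this]
  exact hf.smul_measure_nnreal

theorem HasIntensity.integral [SFinite P] [IsSFiniteKernel Ψ] (hγ : HasIntensity P Ψ γ)
    {f : E d → ℝ} (hf : Integrable f) :
    ∫ ω, ∫ x, f x ∂(Ψ ω) ∂P = γ * ∫ x, f x := by
  have h : Ψ ∘ₘ P = γ • volume := hγ
  rw [← integral_measure_comp (hγ.integrable_comp hf), h, integral_smul_nnreal_measure]
  rfl

theorem HasIntensity.ae_integrable [SFinite P] [IsSFiniteKernel Ψ] (hγ : HasIntensity P Ψ γ)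
    {f : E d → ℝ} (hf : Integrable f) : ∀ᵐ ω ∂P, Integrable f (Ψ ω) := by
  have h := hγ.integrable_comp hf
  rw [Measure.comp_eq_comp_const_apply, ProbabilityTheory.integrable_comp_iff
    (by rw [← Measure.comp_eq_comp_const_apply]; exact h.1)] at h
  simpa using h.1

theorem measurable_kernel_ball [IsSFiniteKernel Ψ] :
    Measurable fun p : Ω × E d => Ψ p.1 (Metric.ball p.2 1) := by
  have ht : MeasurableSet {q : (Ω × E d) × E d | dist q.2 q.1.2 < 1} :=
    measurableSet_lt (by fun_prop) measurable_const
  exact Kernel.measurable_kernel_prodMk_left (κ := Ψ.comap Prod.fst measurable_fst) ht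

section Invariant

variable [AddAction (E d) Ω] [MeasurableVAdd₂ (E d) Ω] [VAddInvariantMeasure (E d) Ω P]

theorem lintegral_ball_sq_eq (hinv : IsInvariant Ψ) (w : E d) :
    ∫⁻ ω, Ψ ω (Metric.ball w 1) ^ 2 ∂P = ∫⁻ ω, Ψ ω (Metric.ball 0 1) ^ 2 ∂P := by
  rw [← lintegral_vadd_eq_self
    (f := fun ω => Ψ ω (Metric.ball 0 1) ^ 2) ((Ψ.measurable_coe measurableSet_ball).pow_const 2) w]
  refine lintegral_congr fun ω => ?_
  rw [hinv, Measure.map_apply (by fun_prop) measurableSet_ball]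
  congr 2
  ext y
  simp [dist_eq_norm]

/-- Exchanging integrals gives `∫ f dΨ ≤ ∫ g(w) Ψ(B(w,1)) dw`. Weighted Cauchy–Schwarz and
stationarity then reduce everything to the second moment of one unit ball. -/
theorem lintegral_sq_lintegral_le [SFinite P] [IsSFiniteKernel Ψ] (hinv : IsInvariant Ψ)
    {f g : E d → ℝ≥0∞} (hg : Measurable g) (hfg : ∀ x, f x ≤ ∫⁻ w in Metric.ball x 1, g w) :
    ∫⁻ ω, (∫⁻ x, f x ∂(Ψ ω)) ^ 2 ∂P ≤
      (∫⁻ w, g w) ^ 2 * ∫⁻ ω, Ψ ω (Metric.ball 0 1) ^ 2 ∂P := by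
  have hu := measurable_kernel_ball (Ψ := Ψ)
  have e : ∀ ω, ∫⁻ x, f x ∂(Ψ ω) ≤ ∫⁻ w, g w * Ψ ω (Metric.ball w 1) := by
    intro ω
    have hset : MeasurableSet {p : E d × E d | dist p.2 p.1 < 1} :=
      measurableSet_lt (by fun_prop) measurable_const
    have hmeas : Measurable fun p : E d × E d =>
        {p : E d × E d | dist p.2 p.1 < 1}.indicator (fun p => g p.2) p :=
      (hg.comp measurable_snd).indicator hset
    calc ∫⁻ x, f x ∂(Ψ ω) ≤ ∫⁻ x, (∫⁻ w in Metric.ball x 1, g w) ∂(Ψ ω) := lintegral_mono hfg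
      _ = ∫⁻ x, (∫⁻ w, {p : E d × E d | dist p.2 p.1 < 1}.indicator (fun p => g p.2) (x, w))
            ∂(Ψ ω) := by
          refine lintegral_congr fun x => ?_
          rw [← lintegral_indicator measurableSet_ball]
          rfl
      _ = ∫⁻ w, ∫⁻ x, {p : E d × E d | dist p.2 p.1 < 1}.indicator (fun p => g p.2) (x, w)
            ∂(Ψ ω) := lintegral_lintegral_swap hmeas.aemeasurable
      _ = ∫⁻ w, g w * Ψ ω (Metric.ball w 1) := by
          refine lintegral_congr fun w => ?_
          rw [← lintegral_indicator_const measurableSet_ball]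
          refine lintegral_congr fun x => ?_
          by_cases hxw : dist x w < 1
          · rw [Set.indicator_of_mem (show x ∈ Metric.ball w 1 from hxw),
              Set.indicator_of_mem (by rwa [Set.mem_ofPred_eq, dist_comm])]
          · rw [Set.indicator_of_notMem (show x ∉ Metric.ball w 1 from hxw),
              Set.indicator_of_notMem (by rwa [Set.mem_ofPred_eq, dist_comm])]
  calc ∫⁻ ω, (∫⁻ x, f x ∂(Ψ ω)) ^ 2 ∂P
      ≤ ∫⁻ ω, (∫⁻ w, g w) * (∫⁻ w, g w * Ψ ω (Metric.ball w 1) ^ 2) ∂P := by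
        refine lintegral_mono fun ω => ?_
        refine le_trans (pow_le_pow_left' (e ω) 2) (lintegral_mul_sq_le hg ?_)
        exact hu.comp measurable_prodMk_left
    _ = (∫⁻ w, g w) * ∫⁻ w, ∫⁻ ω, g w * Ψ ω (Metric.ball w 1) ^ 2 ∂P := by
        have hmeas : Measurable fun p : Ω × E d => g p.2 * Ψ p.1 (Metric.ball p.2 1) ^ 2 :=
          (hg.comp measurable_snd).mul (hu.pow_const 2)
        rw [lintegral_const_mul _ hmeas.lintegral_prod_right',
          lintegral_lintegral_swap hmeas.aemeasurable]
    _ = _ := by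
        simp_rw [lintegral_const_mul _ ((Ψ.measurable_coe measurableSet_ball).pow_const 2),
          lintegral_ball_sq_eq hinv]
        rw [lintegral_mul_const _ hg]
        ring

theorem HasIntegrableDecay.lintegral_sq_lt_top [SFinite P] [IsSFiniteKernel Ψ]
    (hinv : IsInvariant Ψ) (hsq : IsLocallySquareIntegrable P Ψ) {f : E d → ℝ}
    (hf : HasIntegrableDecay f) : ∫⁻ ω, (∫⁻ x, ‖f x‖ₑ ∂(Ψ ω)) ^ 2 ∂P < ∞ := by
  obtain ⟨hm, C, hC⟩ := hf
  set r : ℝ := ((d + 1 : ℕ) : ℝ) with hr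
  have hr0 : 0 ≤ r := Nat.cast_nonneg _
  set v : ℝ≥0∞ := volume (Metric.ball (0 : E d) 1) with hv
  have hv0 : v ≠ 0 := (Metric.measure_ball_pos volume _ one_pos).ne'
  have hvt : v ≠ ∞ := measure_ball_lt_top.ne
  let h : E d → ℝ := fun w => |C| * 2 ^ r * (1 + ‖w‖) ^ (-r)
  have hh : Measurable h := by fun_prop
  -- `v⁻¹` normalises the average over a unit ball. The factor `2 ^ r` in `h` comes from `1 + ‖w‖ ≤
  -- 2 (1 + ‖x‖)` for `w` in the unit ball around `x`.
  let g : E d → ℝ≥0∞ := fun w => v⁻¹ * ‖h w‖ₑ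
  have hg : Measurable g := by fun_prop
  have hgint : ∫⁻ w, g w < ∞ := by
    rw [lintegral_const_mul _ hh.enorm]
    exact ENNReal.mul_lt_top (ENNReal.inv_lt_top.2 (pos_iff_ne_zero.2 hv0))
      ((integrable_one_add_norm_rpow d).const_mul _).2
  refine (lintegral_sq_lintegral_le hinv hg fun x => ?_).trans_lt
    (ENNReal.mul_lt_top (ENNReal.pow_lt_top hgint) hsq)
  rw [lintegral_const_mul _ hh.enorm, mul_comm, ← div_eq_mul_inv,
    ENNReal.le_div_iff_mul_le (.inl hv0) (.inl hvt), hv, ← Measure.addHaar_ball_center volume x,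
    ← setLIntegral_const]
  refine setLIntegral_mono hh.enorm fun w hw => ?_
  rw [enorm_le_iff_norm_le, Real.norm_eq_abs]
  have hw' : ‖w‖ ≤ ‖x‖ + 1 := by
    have h1 := norm_le_norm_add_norm_sub' w x
    rw [mem_ball_iff_norm] at hw
    linarith
  have hx := norm_nonneg x
  have hwn := norm_nonneg w
  refine (hC x).trans (le_trans ?_ (le_abs_self _))
  have h2 : (1 + ‖x‖) ^ (-r) ≤ 2 ^ r * (1 + ‖w‖) ^ (-r) := by
    rw [Real.rpow_neg (by positivity), Real.rpow_neg (by positivity), ← div_eq_mul_inv,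
      ← Real.div_rpow (by positivity) (by positivity),
      ← Real.inv_rpow (by positivity)]
    refine Real.rpow_le_rpow (by positivity) ?_ hr0
    rw [inv_le_iff_one_le_mul₀ (by positivity), div_mul_eq_mul_div, one_le_div (by positivity)]
    linarith
  have h3 : 0 ≤ (1 + ‖x‖) ^ (-r) := by positivity
  calc C * (1 + ‖x‖) ^ (-r) ≤ |C| * (1 + ‖x‖) ^ (-r) := by gcongr; exact le_abs_self C
    _ ≤ |C| * (2 ^ r * (1 + ‖w‖) ^ (-r)) := by gcongr
    _ = h w := by simp only [h]; ring

end Invariant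

end LinearStatistics

/-! ### Variance of a linear statistic as spectral energy -/

section Rigidity

variable {d : ℕ} {Ω : Type*} [MeasurableSpace Ω]

theorem measurable_fourierHat {f : E d → ℂ} (hf : Measurable f) : Measurable (fourierHat f) := by
  have : Measurable fun p : E d × E d =>
      Complex.exp (-(Complex.I * ((inner ℝ p.1 p.2 : ℝ) : ℂ))) * f p.2 :=
    (Continuous.measurable (by fun_prop)).mul (hf.comp measurable_snd)
  exact (this.stronglyMeasurable.integral_prod_right (ν := (volume : Measure (E d)))).measurable

theorem norm_fourierHat_integrand (f : E d → ℂ) (k x : E d) :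
    ‖Complex.exp (-(Complex.I * ((inner ℝ k x : ℝ) : ℂ))) * f x‖ = ‖f x‖ := by
  rw [norm_mul, ← mul_neg, ← Complex.ofReal_neg, mul_comm Complex.I,
    Complex.norm_exp_ofReal_mul_I, one_mul]

theorem integral_tiltedConv {F : E d → ℂ} (hF : Integrable F) :
    ∫ y, tiltedConv F F y = (∫ x, F x) * conj (∫ x, F x) := by
  have hG : Integrable fun u => conj (F (-u)) := by
    have := hF.comp_neg
    exact (LinearIsometryEquiv.integrable_comp_iff (Complex.conjLIE)).2 this
  have h : tiltedConv F F =
      convolution F (fun u => conj (F (-u))) (ContinuousLinearMap.mul ℝ ℂ) := by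
    ext y
    refine integral_congr_ae (.of_forall fun x => ?_)
    simp
  rw [h, integral_convolution (ContinuousLinearMap.mul ℝ ℂ) hF hG, ContinuousLinearMap.mul_apply',
    integral_neg_eq_self (fun u => conj (F u)), integral_conj]

variable {P : Measure Ω} {Ψ : Kernel Ω (E d)} {γ : ℝ≥0}
theorem HasIntegrableDecay.stronglyMeasurable_integral [IsSFiniteKernel Ψ] {f : E d → ℝ}
    (hf : HasIntegrableDecay f) : StronglyMeasurable fun ω => ∫ x, f x ∂(Ψ ω) :=
  hf.1.stronglyMeasurable.integral_kernel

variable [AddAction (E d) Ω] [MeasurableVAdd₂ (E d) Ω] [VAddInvariantMeasure (E d) Ω P]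
  [IsProbabilityMeasure P]

theorem HasIntegrableDecay.integrable_integral_sq [IsSFiniteKernel Ψ]
    (hinv : IsInvariant Ψ) (hsq : IsLocallySquareIntegrable P Ψ) {f : E d → ℝ}
    (hf : HasIntegrableDecay f) : Integrable (fun ω => (∫ x, f x ∂(Ψ ω)) ^ 2) P := by
  refine ⟨(hf.stronglyMeasurable_integral.pow 2).aestronglyMeasurable, ?_⟩
  refine lt_of_le_of_lt (lintegral_mono fun ω => ?_) (hf.lintegral_sq_lt_top hinv hsq)
  rw [enorm_pow]
  gcongr
  exact enorm_integral_le_lintegral_enorm _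

theorem HasIntegrableDecay.integrable_mul_conj [IsSFiniteKernel Ψ]
    (hinv : IsInvariant Ψ) (hsq : IsLocallySquareIntegrable P Ψ) {f : E d → ℝ}
    (hf : HasIntegrableDecay f) :
    Integrable (fun z : E d × E d => (f z.1 : ℂ) * conj (f z.2 : ℂ)) (secondMoment P Ψ) := by
  have hm := hf.1
  refine ⟨Measurable.aestronglyMeasurable (by simp only [Complex.conj_ofReal]; fun_prop), ?_⟩
  have h := hf.lintegral_sq_lt_top hinv hsq
  rw [← lintegral_secondMoment_mul hm.enorm] at h
  refine lt_of_le_of_lt (lintegral_mono fun z => le_of_eq ?_) h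
  rw [enorm_mul, Complex.conj_ofReal, ← ofReal_norm, ← ofReal_norm (E := ℂ),
    Complex.norm_real, Complex.norm_real, ofReal_norm, ofReal_norm]

/-- The second moment of a centered linear statistic. -/
theorem integral_centered_sq [IsSFiniteKernel Ψ]
    (hinv : IsInvariant Ψ) (hsq : IsLocallySquareIntegrable P Ψ) (hγ : HasIntensity P Ψ γ)
    {f : E d → ℝ} (hf : HasIntegrableDecay f) :
    Integrable (fun ω => (∫ x, f x ∂(Ψ ω) - γ * ∫ x, f x) ^ 2) P ∧
      ∫ ω, (∫ x, f x ∂(Ψ ω) - γ * ∫ x, f x) ^ 2 ∂P =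
        ∫ ω, (∫ x, f x ∂(Ψ ω)) ^ 2 ∂P - (γ * ∫ x, f x) ^ 2 := by
  have h2 := hf.integrable_integral_sq hinv hsq
  have h1 : Integrable (fun ω => ∫ x, f x ∂(Ψ ω)) P := by
    have := hγ.integrable_comp hf.integrable
    rw [Measure.comp_eq_comp_const_apply] at this
    simpa using this.integral_comp
  set c := γ * ∫ x, f x with hc
  have e : ∀ ω, (∫ x, f x ∂(Ψ ω) - c) ^ 2 =
      (∫ x, f x ∂(Ψ ω)) ^ 2 - 2 * c * ∫ x, f x ∂(Ψ ω) + c ^ 2 := fun ω => by ring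
  simp_rw [e]
  have h3 : Integrable (fun ω => (∫ x, f x ∂(Ψ ω)) ^ 2 - 2 * c * ∫ x, f x ∂(Ψ ω)) P :=
    h2.sub (h1.const_mul (2 * c))
  refine ⟨h3.add (integrable_const _), ?_⟩
  rw [integral_add h3 (integrable_const _), integral_sub h2 (h1.const_mul (2 * c)),
    integral_const_mul, hγ.integral hf.integrable, ← hc]
  simp
  ring

theorem lintegral_enorm_centered_sq_le [IsSFiniteKernel Ψ]
    (hinv : IsInvariant Ψ) (hsq : IsLocallySquareIntegrable P Ψ) (hγ : HasIntensity P Ψ γ)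
    {f : E d → ℝ} (hf : HasIntegrableDecay f) :
    ∫⁻ ω, ‖∫ x, f x ∂(Ψ ω) - γ * ∫ x, f x‖ₑ ^ 2 ∂P ≤
      ∫⁻ ω, (∫⁻ x, ‖f x‖ₑ ∂(Ψ ω)) ^ 2 ∂P := by
  obtain ⟨hi, he⟩ := integral_centered_sq hinv hsq hγ hf
  have h2 := hf.integrable_integral_sq hinv hsq
  have e : ∀ r : ℝ, ‖r‖ₑ ^ 2 = ENNReal.ofReal (r ^ 2) := fun r => by
    rw [← enorm_pow, Real.enorm_of_nonneg (sq_nonneg r)]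
  calc ∫⁻ ω, ‖∫ x, f x ∂(Ψ ω) - γ * ∫ x, f x‖ₑ ^ 2 ∂P
      = ENNReal.ofReal (∫ ω, (∫ x, f x ∂(Ψ ω) - γ * ∫ x, f x) ^ 2 ∂P) := by
        rw [ofReal_integral_eq_lintegral_ofReal hi (.of_forall fun ω => sq_nonneg _)]
        simp_rw [e]
    _ ≤ ENNReal.ofReal (∫ ω, (∫ x, f x ∂(Ψ ω)) ^ 2 ∂P) := by
        rw [he]
        exact ENNReal.ofReal_le_ofReal (by linarith [sq_nonneg (γ * ∫ x, f x)])
    _ = ∫⁻ ω, ‖∫ x, f x ∂(Ψ ω)‖ₑ ^ 2 ∂P := by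
        rw [ofReal_integral_eq_lintegral_ofReal h2 (.of_forall fun ω => sq_nonneg _)]
        simp_rw [e]
    _ ≤ _ := by
        refine lintegral_mono fun ω => ?_
        gcongr
        exact enorm_integral_le_lintegral_enorm _

/-- This is the spectral identity at `f ⋆ f`: the `α_Φ` term is the second moment of the statistic,
the Lebesgue term is the square of its mean, and the spectral side is the integral of `|f̂|²`. -/
theorem lintegral_enorm_centered_sq_eq (hΨ : IsRandomMeasure Ψ)
    (hinv : IsInvariant Ψ) (hsq : IsLocallySquareIntegrable P Ψ) (hγ : HasIntensity P Ψ γ)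
    {m : Measure (E d)} (hm : IsBartlettSpectralMeasure P Ψ γ m)
    {f : E d → ℝ} (hf : HasIntegrableDecay f) (hft : IsTestFunction fun x => (f x : ℂ)) :
    ∫⁻ ω, ‖∫ x, f x ∂(Ψ ω) - γ * ∫ x, f x‖ₑ ^ 2 ∂P =
      ∫⁻ k, ‖fourierHat (fun x => (f x : ℂ)) k‖ₑ ^ 2 ∂m := by
  have := hΨ.isSFiniteKernel
  obtain ⟨hi, he⟩ := integral_centered_sq hinv hsq hγ hf
  let F : E d → ℂ := fun x => f x
  have hint : Integrable (fun z : E d × E d => F z.1 * conj (F z.2)) (secondMoment P Ψ) :=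
    hf.integrable_mul_conj hinv hsq
  have hspec := hm.spectral F F hft hft
  have hmi := hm.integrable F F hft hft
  have hsqn : ∀ z : ℂ, z * conj z = ((‖z‖ ^ 2 : ℝ) : ℂ) := fun z => by
    rw [Complex.mul_conj']; push_cast; rfl
  have hFΨ : ∀ ω, ∫ x, F x ∂(Ψ ω) = ((∫ x, f x ∂(Ψ ω) : ℝ) : ℂ) :=
    fun ω => integral_complex_ofReal
  have hFv : ∫ x, F x = ((∫ x, f x : ℝ) : ℂ) := integral_complex_ofReal
  have h1 := integral_tiltedConv_reducedSecondMoment hΨ hinv hft.1 hint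
  have h2 : ∫ z, F z.1 * conj (F z.2) ∂(secondMoment P Ψ) =
      ((∫ ω, (∫ x, f x ∂(Ψ ω)) ^ 2 ∂P : ℝ) : ℂ) := by
    rw [integral_secondMoment_mul_conj hint, ← integral_complex_ofReal]
    refine integral_congr_ae (.of_forall fun ω => ?_)
    simp only [hFΨ, Complex.conj_ofReal]
    push_cast
    ring
  have h3 : ∫ y, tiltedConv F F y = (((∫ x, f x) ^ 2 : ℝ) : ℂ) := by
    rw [integral_tiltedConv (F := F) hf.integrable.ofReal, hFv, Complex.conj_ofReal]
    push_cast
    ring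
  have h4 : ∫ k, fourierHat F k * conj (fourierHat F k) ∂m =
      ((∫ k, ‖fourierHat F k‖ ^ 2 ∂m : ℝ) : ℂ) := by
    rw [← integral_complex_ofReal]
    exact integral_congr_ae (.of_forall fun k => hsqn _)
  have hreal : ∫ ω, (∫ x, f x ∂(Ψ ω)) ^ 2 ∂P - (γ : ℝ) ^ 2 * (∫ x, f x) ^ 2 =
      ∫ k, ‖fourierHat F k‖ ^ 2 ∂m := by
    rw [covarianceIntegral, h1.trans h2, h3, h4] at hspec
    exact_mod_cast hspec
  have hmi' : Integrable (fun k => ‖fourierHat F k‖ ^ 2) m := by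
    have := hmi.re
    simpa only [hsqn, RCLike.ofReal_re, Complex.coe_algebraMap, RCLike.re_to_complex,
      Complex.ofReal_re] using this
  have e : ∀ r : ℝ, ‖r‖ₑ ^ 2 = ENNReal.ofReal (r ^ 2) := fun r => by
    rw [← enorm_pow, Real.enorm_of_nonneg (sq_nonneg r)]
  have e' : ∀ z : ℂ, ‖z‖ₑ ^ 2 = ENNReal.ofReal (‖z‖ ^ 2) := fun z => by
    rw [← ofReal_norm, ENNReal.ofReal_pow (norm_nonneg z)]
  change _ = ∫⁻ k, ‖fourierHat F k‖ₑ ^ 2 ∂m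
  simp_rw [e, e']
  rw [← ofReal_integral_eq_lintegral_ofReal hi (.of_forall fun ω => sq_nonneg _),
    ← ofReal_integral_eq_lintegral_ofReal hmi' (.of_forall fun k => sq_nonneg _), he, ← hreal]
  congr 1
  ring

end Rigidity

/-! ### Rigidity of statistics with spectrum in the gap -/

section Rigidity

open Filter Topology

variable {d : ℕ} {Ω : Type*} [MeasurableSpace Ω]

theorem tendsto_setLIntegral_compl_ball {μ : Measure (E d)} {f : E d → ℝ≥0∞} (hf : Measurable f)
    (hfin : ∫⁻ x, f x ∂μ ≠ ∞) :
    Tendsto (fun n : ℕ => ∫⁻ x in (Metric.ball (0 : E d) n)ᶜ, f x ∂μ) atTop (𝓝 0) := by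
  have h : Tendsto (fun n : ℕ => ∫⁻ x, (Metric.ball (0 : E d) n)ᶜ.indicator f x ∂μ) atTop
      (𝓝 (∫⁻ _, 0 ∂μ)) := by
    refine tendsto_lintegral_of_dominated_convergence f
      (fun n => hf.indicator measurableSet_ball.compl)
      (fun n => .of_forall fun x => Set.indicator_le_self _ _ x) hfin (.of_forall fun x => ?_)
    obtain ⟨N, hN⟩ := exists_nat_gt ‖x‖
    refine tendsto_const_nhds.congr' ?_
    filter_upwards [eventually_ge_atTop N] with n hn
    have : x ∈ Metric.ball (0 : E d) n := by
      rw [mem_ball_zero_iff]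
      exact hN.trans_le (by exact_mod_cast hn)
    simp [this]
  simpa [lintegral_indicator measurableSet_ball.compl] using h

theorem tendsto_integral_indicator_ball {G : Type*} [NormedAddCommGroup G] [NormedSpace ℝ G]
    {μ : Measure (E d)} {f : E d → G} (hf : Integrable f μ) :
    Tendsto (fun n : ℕ => ∫ x, (Metric.ball (0 : E d) n).indicator f x ∂μ) atTop
      (𝓝 (∫ x, f x ∂μ)) := by
  refine tendsto_integral_of_dominated_convergence (fun x => ‖f x‖)
    (fun n => hf.1.indicator measurableSet_ball) hf.norm
    (fun n => .of_forall fun x => norm_indicator_le_norm_self f x) (.of_forall fun x => ?_)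
  obtain ⟨N, hN⟩ := exists_nat_gt ‖x‖
  refine tendsto_const_nhds.congr' ?_
  filter_upwards [eventually_ge_atTop N] with n hn
  have : x ∈ Metric.ball (0 : E d) n := by
    rw [mem_ball_zero_iff]
    exact hN.trans_le (by exact_mod_cast hn)
  simp [this]

theorem tendsto_fourierHat_indicator_ball {f : E d → ℂ} (hf : Integrable f) (k : E d) :
    Tendsto (fun n : ℕ => fourierHat ((Metric.ball (0 : E d) n).indicator f) k) atTop
      (𝓝 (fourierHat f k)) := by
  have hi : Integrable fun x => Complex.exp (-(Complex.I * ((inner ℝ k x : ℝ) : ℂ))) * f x := by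
    refine hf.norm.mono' ((Continuous.aestronglyMeasurable (by fun_prop)).mul hf.1)
      (.of_forall fun x => (norm_fourierHat_integrand f k x).le)
  refine (tendsto_integral_indicator_ball hi).congr fun n => ?_
  refine integral_congr_ae (.of_forall fun x => ?_)
  by_cases hx : x ∈ Metric.ball (0 : E d) n <;> simp [hx]

theorem fourierHat_sub {f g : E d → ℂ} (hf : Integrable f) (hg : Integrable g) (k : E d) :
    fourierHat (fun x => f x - g x) k = fourierHat f k - fourierHat g k := by
  have hi : ∀ {f : E d → ℂ}, Integrable f →
      Integrable fun x => Complex.exp (-(Complex.I * ((inner ℝ k x : ℝ) : ℂ))) * f x := fun hf =>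
    hf.norm.mono' ((Continuous.aestronglyMeasurable (by fun_prop)).mul hf.1)
      (.of_forall fun x => (norm_fourierHat_integrand _ k x).le)
  rw [fourierHat, fourierHat, fourierHat, ← integral_sub (hi hf) (hi hg)]
  simp_rw [mul_sub]

theorem ofReal_indicator (s : Set (E d)) (f : E d → ℝ) :
    (fun x => ((s.indicator f x : ℝ) : ℂ)) = s.indicator fun x => (f x : ℂ) := by
  ext x
  by_cases hx : x ∈ s <;> simp [hx]

variable {P : Measure Ω} {Ψ : Kernel Ω (E d)} {γ : ℝ≥0}
variable [AddAction (E d) Ω] [MeasurableVAdd₂ (E d) Ω] [VAddInvariantMeasure (E d) Ω P]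
  [IsProbabilityMeasure P]

/-- Where `f̂ = 0`, the transforms of `f 1_{B_n}` and `f 1_{B_nᶜ}` differ only by a sign, and `m`
charges only such frequencies. The energy of the truncation is thus that of the tail, which the
second moment of the tail statistic controls. -/
theorem lintegral_enorm_fourierHat_indicator_ball_le (hΨ : IsRandomMeasure Ψ)
    (hinv : IsInvariant Ψ) (hsq : IsLocallySquareIntegrable P Ψ) (hγ : HasIntensity P Ψ γ)
    {m : Measure (E d)} (hm : IsBartlettSpectralMeasure P Ψ γ m)
    {ε : ℝ} (hε : m (Metric.ball 0 ε) = 0) {f : E d → ℝ} (hf : HasIntegrableDecay f)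
    (hfε : ∀ k, ε ≤ ‖k‖ → fourierHat (fun x => (f x : ℂ)) k = 0) (n : ℕ) :
    ∫⁻ k, ‖fourierHat (fun x => (((Metric.ball (0 : E d) n).indicator f x : ℝ) : ℂ)) k‖ₑ ^ 2 ∂m ≤
      ∫⁻ ω, (∫⁻ x in (Metric.ball (0 : E d) n)ᶜ, ‖f x‖ₑ ∂(Ψ ω)) ^ 2 ∂P := by
  have := hΨ.isSFiniteKernel
  let B : ℕ → Set (E d) := fun n => Metric.ball 0 n
  have hB : ∀ n, MeasurableSet (B n) := fun n => measurableSet_ball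
  let F : E d → ℂ := fun x => f x
  have hF : Integrable F := hf.integrable.ofReal
  -- The tail has unbounded support, so the variance identity is applied to its truncations and
  -- Fatou's lemma passes to the limit.
  let g : ℕ → E d → ℝ := fun M => (B M).indicator ((B n)ᶜ.indicator f)
  have hg : ∀ M, HasIntegrableDecay (g M) := fun M => (hf.indicator (hB n).compl).indicator (hB M)
  have hgt : ∀ M, IsTestFunction fun x => (g M x : ℂ) := fun M =>
    (hf.indicator (hB n).compl).isTestFunction (hB M) subset_rfl
  have hlim : ∀ k, Tendsto (fun M => fourierHat (fun x => (g M x : ℂ)) k) atTop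
      (𝓝 (fourierHat ((B n)ᶜ.indicator F) k)) := by
    intro k
    have : ∀ M, (fun x => (g M x : ℂ)) = (B M).indicator ((B n)ᶜ.indicator F) := by
      intro M
      simp only [g]
      rw [ofReal_indicator, ofReal_indicator]
    simp_rw [this]
    exact tendsto_fourierHat_indicator_ball (hF.indicator (hB n).compl) k
  have hdiff : ∀ k, fourierHat ((B n)ᶜ.indicator F) k =
      fourierHat F k - fourierHat ((B n).indicator F) k := by
    intro k
    rw [← fourierHat_sub hF (hF.indicator (hB n))]
    congr 1
    ext x
    rw [Set.indicator_compl]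
    rfl
  have hae : ∀ᵐ k ∂m, ε ≤ ‖k‖ := by
    rw [ae_iff]
    convert hε using 2
    ext k
    simp
  have hmeas : ∀ M, Measurable fun k => ‖fourierHat (fun x => (g M x : ℂ)) k‖ₑ ^ 2 := fun M =>
    (measurable_fourierHat (hgt M).1).enorm.pow_const 2
  rw [ofReal_indicator]
  calc ∫⁻ k, ‖fourierHat ((B n).indicator F) k‖ₑ ^ 2 ∂m
      = ∫⁻ k, liminf (fun M => ‖fourierHat (fun x => (g M x : ℂ)) k‖ₑ ^ 2) atTop ∂m := by
        refine lintegral_congr_ae ?_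
        filter_upwards [hae] with k hk
        have h1 : Tendsto (fun M => ‖fourierHat (fun x => (g M x : ℂ)) k‖ₑ ^ 2) atTop
            (𝓝 (‖fourierHat ((B n)ᶜ.indicator F) k‖ₑ ^ 2)) :=
          ((ENNReal.continuous_pow 2).tendsto _).comp ((continuous_enorm.tendsto _).comp (hlim k))
        rw [h1.liminf_eq, hdiff, hfε k hk, zero_sub, enorm_neg]
    _ ≤ liminf (fun M => ∫⁻ k, ‖fourierHat (fun x => (g M x : ℂ)) k‖ₑ ^ 2 ∂m) atTop :=
        lintegral_liminf_le hmeas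
    _ ≤ liminf (fun _ : ℕ => ∫⁻ ω, (∫⁻ x in (B n)ᶜ, ‖f x‖ₑ ∂(Ψ ω)) ^ 2 ∂P) atTop := by
        refine liminf_le_liminf (.of_forall fun M => ?_)
        beta_reduce
        rw [← lintegral_enorm_centered_sq_eq hΨ hinv hsq hγ hm (hg M) (hgt M)]
        refine (lintegral_enorm_centered_sq_le hinv hsq hγ (hg M)).trans
          (lintegral_mono fun ω => ?_)
        refine pow_le_pow_left' ?_ 2
        rw [← lintegral_indicator (hB n).compl]
        refine lintegral_mono fun x => ?_
        simp only [g]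
        rw [← enorm_indicator_eq_indicator_enorm]
        exact enorm_indicator_le_enorm_self _ _
    _ = _ := by simp [B]

/-- Linear statistics of test functions with spectrum in the gap are almost surely constant. -/
theorem ae_integral_eq_of_fourierHat_eq_zero (hΨ : IsRandomMeasure Ψ)
    (hinv : IsInvariant Ψ) (hsq : IsLocallySquareIntegrable P Ψ) (hγ : HasIntensity P Ψ γ)
    {m : Measure (E d)} (hm : IsBartlettSpectralMeasure P Ψ γ m)
    {ε : ℝ} (hε : m (Metric.ball 0 ε) = 0) {f : E d → ℝ} (hf : HasIntegrableDecay f)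
    (hfε : ∀ k, ε ≤ ‖k‖ → fourierHat (fun x => (f x : ℂ)) k = 0) :
    ∀ᵐ ω ∂P, ∫ x, f x ∂(Ψ ω) = γ * ∫ x, f x := by
  have := hΨ.isSFiniteKernel
  let B : ℕ → Set (E d) := fun n => Metric.ball 0 n
  have hB : ∀ n, MeasurableSet (B n) := fun n => measurableSet_ball
  let g : ℕ → E d → ℝ := fun n => (B n).indicator f
  have hg : ∀ n, HasIntegrableDecay (g n) := fun n => hf.indicator (hB n)
  have hgt : ∀ n, IsTestFunction fun x => (g n x : ℂ) := fun n =>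
    hf.isTestFunction (hB n) subset_rfl
  -- These tail moments tend to zero by dominated convergence and bound the variances of the
  -- truncated statistics; a second use of Fatou's lemma then makes the full variance vanish.
  let T : ℕ → ℝ≥0∞ := fun n => ∫⁻ ω, (∫⁻ x in (B n)ᶜ, ‖f x‖ₑ ∂(Ψ ω)) ^ 2 ∂P
  have hT : Tendsto T atTop (𝓝 0) := by
    have hfin := hf.lintegral_sq_lt_top hinv hsq
    have hm1 : Measurable fun ω => ∫⁻ x, ‖f x‖ₑ ∂(Ψ ω) := hf.1.enorm.lintegral_kernel
    have h : Tendsto T atTop (𝓝 (∫⁻ _, 0 ∂P)) := by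
      refine tendsto_lintegral_of_dominated_convergence
        (fun ω => (∫⁻ x, ‖f x‖ₑ ∂(Ψ ω)) ^ 2) (fun n => ?_) (fun n => .of_forall fun ω => ?_)
        hfin.ne ?_
      · simp_rw [← lintegral_indicator (hB n).compl]
        exact ((hf.1.enorm.indicator (hB n).compl).lintegral_kernel).pow_const 2
      · exact pow_le_pow_left' (setLIntegral_le_lintegral _ _) 2
      · filter_upwards [ae_lt_top (hm1.pow_const 2) hfin.ne] with ω hω
        have := tendsto_setLIntegral_compl_ball (μ := Ψ ω) hf.1.enorm
          (fun h => by simp [h] at hω)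
        have h0 := ((ENNReal.continuous_pow 2).tendsto _).comp this
        rw [zero_pow two_ne_zero] at h0
        exact h0
    simpa using h
  have hzero : ∫⁻ ω, ‖∫ x, f x ∂(Ψ ω) - γ * ∫ x, f x‖ₑ ^ 2 ∂P ≤ 0 := by
    calc ∫⁻ ω, ‖∫ x, f x ∂(Ψ ω) - γ * ∫ x, f x‖ₑ ^ 2 ∂P
        = ∫⁻ ω, liminf (fun n => ‖∫ x, g n x ∂(Ψ ω) - γ * ∫ x, g n x‖ₑ ^ 2) atTop ∂P := by
          refine lintegral_congr_ae ?_
          filter_upwards [hγ.ae_integrable hf.integrable] with ω hω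
          have h1 : Tendsto (fun n => ‖∫ x, g n x ∂(Ψ ω) - γ * ∫ x, g n x‖ₑ ^ 2) atTop
              (𝓝 (‖∫ x, f x ∂(Ψ ω) - γ * ∫ x, f x‖ₑ ^ 2)) :=
            ((ENNReal.continuous_pow 2).tendsto _).comp ((continuous_enorm.tendsto _).comp
              ((tendsto_integral_indicator_ball hω).sub
                ((tendsto_integral_indicator_ball hf.integrable).const_mul _)))
          rw [h1.liminf_eq]
      _ ≤ liminf (fun n => ∫⁻ ω, ‖∫ x, g n x ∂(Ψ ω) - γ * ∫ x, g n x‖ₑ ^ 2 ∂P) atTop :=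
          lintegral_liminf_le fun n =>
            ((hg n).stronglyMeasurable_integral.measurable.sub_const _).enorm.pow_const 2
      _ ≤ liminf T atTop := by
          refine liminf_le_liminf (.of_forall fun n => ?_)
          beta_reduce
          rw [lintegral_enorm_centered_sq_eq hΨ hinv hsq hγ hm (hg n) (hgt n)]
          exact lintegral_enorm_fourierHat_indicator_ball_le hΨ hinv hsq hγ hm hε hf hfε n
      _ = 0 := hT.liminf_eq
  rw [nonpos_iff_eq_zero, lintegral_eq_zero_iff
    ((hf.stronglyMeasurable_integral.measurable.sub_const _).enorm.pow_const 2)] at hzero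
  filter_upwards [hzero] with ω hω
  simpa [sub_eq_zero] using hω

end Rigidity

/-! ### Deterministic translation kernels and the comparison of the distances -/

section Translation

variable {d : ℕ} {Ω : Type*} [MeasurableSpace Ω]

/-- The deterministic kernel that moves `x` to `x + Y`, with `Y` distributed according to `μ`. -/
noncomputable def translationKernel (Ω : Type*) [MeasurableSpace Ω] (μ : Measure (E d)) :
    Kernel (Ω × E d) (E d) :=
  (Kernel.const (Ω × E d) μ ×ₖ Kernel.deterministic Prod.snd measurable_snd).map
    fun z => z.1 + z.2

variable (μ : Measure (E d)) [IsProbabilityMeasure μ]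

instance : IsMarkovKernel (translationKernel Ω μ) :=
  Kernel.IsMarkovKernel.map _ (by fun_prop)

theorem translationKernel_apply (ω : Ω) (x : E d) :
    translationKernel Ω μ (ω, x) = μ.map fun y => y + x := by
  rw [translationKernel, Kernel.map_apply _ (by fun_prop), Kernel.prod_apply, Kernel.const_apply,
    Kernel.deterministic_apply, Measure.prod_dirac, Measure.map_map (by fun_prop) (by fun_prop)]
  rfl

theorem translationKernel_apply_zero (ω : Ω) : translationKernel Ω μ (ω, 0) = μ := by
  rw [translationKernel_apply]
  simp

theorem isDeterministicKernel_translationKernel :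
    IsDeterministicKernel (translationKernel Ω μ) := fun ω ω' x => by
  rw [translationKernel_apply, translationKernel_apply]

theorem isInvariantKernel_translationKernel [AddAction (E d) Ω] :
    IsInvariantKernel (translationKernel Ω μ) := fun z ω x => by
  rw [translationKernel_apply, translationKernel_apply, Measure.map_map (by fun_prop) (by fun_prop)]
  congr 1
  ext1 y
  simp [add_sub_assoc]

theorem lintegral_transport (K : Kernel (Ω × E d) (E d)) (ω : Ω) (ν : Measure (E d))
    {h : E d → ℝ≥0∞} (hh : Measurable h) :
    ∫⁻ y, h y ∂(transport K ω ν) = ∫⁻ x, (∫⁻ y, h y ∂(K (ω, x))) ∂ν :=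
  Measure.lintegral_bind (K.measurable.comp measurable_prodMk_left).aemeasurable hh.aemeasurable

theorem lintegral_transport_translationKernel (ω : Ω) (ν : Measure (E d)) {h : E d → ℝ≥0∞}
    (hh : Measurable h) :
    ∫⁻ y, h y ∂(transport (translationKernel Ω μ) ω ν) = ∫⁻ x, (∫⁻ y, h (y + x) ∂μ) ∂ν := by
  rw [lintegral_transport _ _ _ hh]
  refine lintegral_congr fun x => ?_
  rw [translationKernel_apply, lintegral_map hh (by fun_prop)]

theorem transport_translationKernel_volume (ω : Ω) :
    transport (translationKernel Ω μ) ω volume = volume := by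
  refine Measure.ext_of_lintegral _ fun h hh => ?_
  rw [lintegral_transport_translationKernel _ _ _ hh, lintegral_lintegral_swap (by fun_prop)]
  simp_rw [lintegral_add_left_eq_self h]
  simp

theorem absMoment_translationKernel (P : Measure Ω) (p : ℝ) :
    absMoment P p (translationKernel Ω μ) = (∫⁻ x, ‖x‖ₑ ^ p ∂μ) * P Set.univ := by
  simp_rw [absMoment, translationKernel_apply_zero, lintegral_const]

theorem abs_prod_coord_le {q : ℕ} (j : Fin q → Fin d) (x : E d) :
    |∏ i, x (j i)| ≤ ‖x‖ ^ q := by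
  rw [Finset.abs_prod]
  refine (Finset.prod_le_prod (fun i _ => abs_nonneg _)
    fun i _ => (PiLp.norm_apply_le x (j i) : |x (j i)| ≤ ‖x‖)).trans ?_
  simp

/-- Given `K`, take for `L` the translation by the `P`-average of the laws `K_0`. Both costs agree,
hence the factor 2, and averaging an almost surely constant moment returns that constant. -/
theorem dDist_le_two_mul_dTildeDist [AddAction (E d) Ω] (P : Measure Ω) [IsProbabilityMeasure P]
    (p : ℝ) (Φ : Kernel Ω (E d)) (γ : ℝ≥0) :
    dDist P p Φ γ ≤ 2 * dTildeDist P p Φ γ := by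
  rw [mul_comm, ← ENNReal.div_le_iff_le_mul (.inl two_ne_zero) (.inl ENNReal.ofNat_ne_top)]
  refine le_sInf ?_
  rintro r ⟨K, hK, hKinv, hKΦ, hKmom, rfl⟩
  rw [ENNReal.div_le_iff_le_mul (.inl two_ne_zero) (.inl ENNReal.ofNat_ne_top), mul_two]
  obtain htop | hfin := eq_or_ne (absMoment P p K) ∞
  · simp [htop]
  let κ : Kernel Ω (E d) := K.comap (fun ω => (ω, 0)) measurable_prodMk_right
  let μ : Measure (E d) := κ ∘ₘ P
  have hκ : ∀ ω, κ ω = K (ω, 0) := fun ω => rfl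
  have hμp : ∫⁻ x, ‖x‖ₑ ^ p ∂μ = absMoment P p K := by
    rw [Measure.lintegral_bind (Kernel.aemeasurable _) (by fun_prop)]
    rfl
  have hLmom : absMoment P p (translationKernel Ω μ) = absMoment P p K := by
    rw [absMoment_translationKernel, measure_univ, mul_one, hμp]
  refine sInf_le ⟨K, translationKernel Ω μ, hK, inferInstance, hKinv,
    isInvariantKernel_translationKernel μ, hKΦ,
    .of_forall fun ω => (transport_translationKernel_volume μ ω).symm, fun q hq1 hq => ?_,
    by rw [hLmom]⟩
  obtain ⟨c, hc⟩ := hKmom q hq1 hq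
  have hcμ : momentTensor q μ = c := by
    ext j
    have hint : Integrable (fun x : E d => ∏ i, x (j i)) μ := by
      refine ⟨Measurable.aestronglyMeasurable (by fun_prop), ?_⟩
      -- The constraint `q ≤ p / 2 - 1` forces `q ≤ p`, so the finite `p`-th moment makes the
      -- monomial integrable and permits averaging with Fubini.
      have hle : ∀ x : E d, ‖∏ i, x (j i)‖ₑ ≤ 1 + ‖x‖ₑ ^ p := by
        intro x
        have h1 : ‖∏ i, x (j i)‖ₑ ≤ ‖x‖ₑ ^ (q : ℝ) := by
          rw [ENNReal.rpow_natCast, ← enorm_norm x, ← enorm_pow, enorm_le_iff_norm_le,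
            Real.norm_eq_abs, Real.norm_of_nonneg (by positivity)]
          exact abs_prod_coord_le j x
        refine h1.trans ?_
        obtain hx | hx := le_total ‖x‖ₑ 1
        · exact (ENNReal.rpow_le_one hx (by positivity)).trans le_self_add
        · exact (ENNReal.rpow_le_rpow_of_exponent_le hx (by linarith)).trans le_add_self
      refine (lintegral_mono hle).trans_lt ?_
      rw [lintegral_add_left measurable_const, hμp]
      simp only [lintegral_const, measure_univ, mul_one]
      exact ENNReal.add_lt_top.2 ⟨ENNReal.one_lt_top, hfin.lt_top⟩
    rw [momentTensor, integral_measure_comp hint]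
    have : ∀ᵐ ω ∂P, ∫ x, ∏ i, x (j i) ∂(κ ω) = c j := by
      filter_upwards [hc] with ω hω
      exact congrFun hω j
    rw [integral_congr_ae this]
    simp
  filter_upwards [hc] with ω hω
  rw [hω, translationKernel_apply_zero, hcμ]

end Translation

/-! ### Transport kernels with density with respect to `Ψ` -/

section DensityKernel

variable {d : ℕ} {Ω : Type*} [MeasurableSpace Ω] {P : Measure Ω} {Ψ : Kernel Ω (E d)}
  {γ : ℝ≥0} {w : E d → ℝ≥0∞}

/-- The kernel `γ⁻¹ w(y - x) Ψ(dy)`. -/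
noncomputable def densityKernel (Ψ : Kernel Ω (E d)) [IsSFiniteKernel Ψ] (γ : ℝ≥0)
    (w : E d → ℝ≥0∞) :
    Kernel (Ω × E d) (E d) :=
  (Ψ.comap Prod.fst measurable_fst).withDensity fun p y => (γ : ℝ≥0∞)⁻¹ * w (y - p.2)

variable [IsSFiniteKernel Ψ]

theorem densityKernel_apply (hw : Measurable w) (ω : Ω) (x : E d) :
    densityKernel Ψ γ w (ω, x) = (Ψ ω).withDensity fun y => (γ : ℝ≥0∞)⁻¹ * w (y - x) := by
  rw [densityKernel, Kernel.withDensity_apply _ (by fun_prop)]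
  rfl

theorem lintegral_densityKernel (hw : Measurable w) (ω : Ω) (x : E d) {h : E d → ℝ≥0∞}
    (hh : Measurable h) :
    ∫⁻ y, h y ∂(densityKernel Ψ γ w (ω, x)) =
      (γ : ℝ≥0∞)⁻¹ * ∫⁻ y, w (y - x) * h y ∂(Ψ ω) := by
  rw [densityKernel_apply hw, lintegral_withDensity_eq_lintegral_mul _ (by fun_prop) hh,
    ← lintegral_const_mul _ (by fun_prop)]
  simp only [Pi.mul_apply, mul_assoc]

theorem densityKernel_apply_univ (hw : Measurable w) (ω : Ω) (x : E d) :
    densityKernel Ψ γ w (ω, x) Set.univ = (γ : ℝ≥0∞)⁻¹ * ∫⁻ y, w (y - x) ∂(Ψ ω) := by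
  simpa using lintegral_densityKernel (γ := γ) (Ψ := Ψ) hw ω x measurable_one

theorem isInvariantKernel_densityKernel [AddAction (E d) Ω] (hinv : IsInvariant Ψ)
    (hw : Measurable w) : IsInvariantKernel (densityKernel Ψ γ w) := fun z ω x => by
  refine Measure.ext_of_lintegral _ fun h hh => ?_
  rw [lintegral_densityKernel hw _ _ hh, hinv, lintegral_map (by fun_prop) (by fun_prop),
    lintegral_map hh (by fun_prop), lintegral_densityKernel hw _ _ (by fun_prop)]
  simp

open Classical in
/-- The kernel `γ⁻¹ w(y - x) Ψ(dy)` where it is a probability measure, and the translation by `μ`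
elsewhere. -/
noncomputable def normalizedKernel (Ψ : Kernel Ω (E d)) [IsSFiniteKernel Ψ] (γ : ℝ≥0)
    (w : E d → ℝ≥0∞) (μ : Measure (E d)) : Kernel (Ω × E d) (E d) :=
  Kernel.piecewise (s := (fun p => densityKernel Ψ γ w p Set.univ) ⁻¹' {1})
    ((densityKernel Ψ γ w).measurable_coe .univ (measurableSet_singleton 1))
    (densityKernel Ψ γ w) (translationKernel Ω μ)

theorem normalizedKernel_of_eq {μ : Measure (E d)} {p : Ω × E d}
    (h : densityKernel Ψ γ w p Set.univ = 1) :
    normalizedKernel Ψ γ w μ p = densityKernel Ψ γ w p := by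
  classical
  rw [normalizedKernel, Kernel.piecewise_apply, if_pos (by exact h)]

theorem normalizedKernel_of_ne {μ : Measure (E d)} {p : Ω × E d}
    (h : densityKernel Ψ γ w p Set.univ ≠ 1) :
    normalizedKernel Ψ γ w μ p = translationKernel Ω μ p := by
  classical
  rw [normalizedKernel, Kernel.piecewise_apply, if_neg (by exact h)]

instance (μ : Measure (E d)) [IsProbabilityMeasure μ] :
    IsMarkovKernel (normalizedKernel Ψ γ w μ) := ⟨fun p => by
  by_cases h : densityKernel Ψ γ w p Set.univ = 1
  · rw [normalizedKernel_of_eq h]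
    exact ⟨h⟩
  · rw [normalizedKernel_of_ne h]
    infer_instance⟩

theorem isInvariantKernel_normalizedKernel [AddAction (E d) Ω] (hinv : IsInvariant Ψ)
    (hw : Measurable w) (μ : Measure (E d)) [IsProbabilityMeasure μ] :
    IsInvariantKernel (normalizedKernel Ψ γ w μ) := fun z ω x => by
  have h0 := isInvariantKernel_densityKernel (γ := γ) hinv hw z ω x
  have h1 : densityKernel Ψ γ w (z +ᵥ ω, x - z) Set.univ =
      densityKernel Ψ γ w (ω, x) Set.univ := by
    rw [h0, Measure.map_apply (by fun_prop) .univ, Set.preimage_univ]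
  by_cases h : densityKernel Ψ γ w (ω, x) Set.univ = 1
  · rw [normalizedKernel_of_eq h, normalizedKernel_of_eq (h1.trans h), h0]
  · rw [normalizedKernel_of_ne h, normalizedKernel_of_ne (by rwa [h1]),
      isInvariantKernel_translationKernel μ z ω x]

/-- Stationarity carries the identity from the origin to each fixed `x`, with an exceptional event
depending on `x`; Fubini exchanges the two quantifiers. -/
theorem ae_ae_lintegral_sub_eq [AddAction (E d) Ω] [MeasurableVAdd₂ (E d) Ω] [SFinite P]
    [VAddInvariantMeasure (E d) Ω P] (hinv : IsInvariant Ψ) (hw : Measurable w)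
    (h : ∀ᵐ ω ∂P, ∫⁻ y, w y ∂(Ψ ω) = γ) :
    ∀ᵐ ω ∂P, ∀ᵐ x, ∫⁻ y, w (y - x) ∂(Ψ ω) = γ := by
  have hm : Measurable fun p : Ω × E d => ∫⁻ y, w (y - p.2) ∂(Ψ p.1) := by
    have : Measurable fun q : (Ω × E d) × E d => w (q.2 - q.1.2) := by fun_prop
    exact this.lintegral_kernel_prod_right (κ := Ψ.comap Prod.fst measurable_fst)
  refine (Measure.ae_ae_comm (p := fun ω x => ∫⁻ y, w (y - x) ∂(Ψ ω) = γ)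
    (hm (measurableSet_singleton _))).2 (.of_forall fun x => ?_)
  filter_upwards [ae_vadd h x] with ω hω
  rw [← hω, hinv, lintegral_map hw (by fun_prop)]

/-- The exceptional `x` are Lebesgue-null, so the fallback branch contributes nothing. Integrating
`w(y - x)` over `x` gives 1 and leaves `γ⁻¹ Ψ`. -/
theorem transport_normalizedKernel_volume (hγ0 : γ ≠ 0) (hw : Measurable w)
    (hw1 : ∫⁻ x, w x = 1) {μ : Measure (E d)} {ω : Ω}
    (h : ∀ᵐ x, ∫⁻ y, w (y - x) ∂(Ψ ω) = γ) :
    Ψ ω = γ • transport (normalizedKernel Ψ γ w μ) ω volume := by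
  have hγ0' : (γ : ℝ≥0∞) ≠ 0 := by exact_mod_cast hγ0
  refine Measure.ext_of_lintegral _ fun f hf => ?_
  have e : ∫⁻ y, f y ∂(transport (normalizedKernel Ψ γ w μ) ω volume) =
      (γ : ℝ≥0∞)⁻¹ * ∫⁻ y, f y ∂(Ψ ω) := by
    calc ∫⁻ y, f y ∂(transport (normalizedKernel Ψ γ w μ) ω volume)
        = ∫⁻ x, (γ : ℝ≥0∞)⁻¹ * ∫⁻ y, w (y - x) * f y ∂(Ψ ω) := by
          rw [lintegral_transport _ _ _ hf]
          refine lintegral_congr_ae ?_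
          filter_upwards [h] with x hx
          rw [normalizedKernel_of_eq, lintegral_densityKernel hw _ _ hf]
          rw [densityKernel_apply_univ hw, hx, ENNReal.inv_mul_cancel hγ0' ENNReal.coe_ne_top]
      _ = (γ : ℝ≥0∞)⁻¹ * ∫⁻ y, (∫⁻ x, w (y - x) * f y) ∂(Ψ ω) := by
          rw [lintegral_const_mul', lintegral_lintegral_swap (by fun_prop)]
          exact ENNReal.inv_ne_top.2 hγ0'
      _ = _ := by
          congr 1
          refine lintegral_congr fun y => ?_
          rw [lintegral_mul_const _ (by fun_prop), lintegral_sub_left_eq_self w y, hw1, one_mul]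
  rw [lintegral_smul_measure, e]
  change _ = (γ : ℝ≥0∞) * _
  rw [← mul_assoc, ENNReal.mul_inv_cancel hγ0' ENNReal.coe_ne_top, one_mul]

/-- The reflection makes the transported measure have density `x ↦ ∫ w(y - x) Ψ(dy)`, the same
statistic that normalises the forward kernel. -/
theorem transport_translationKernel_neg (hw : Measurable w)
    {μ : Measure (E d)} [IsProbabilityMeasure μ] (hμ : μ = (volume.withDensity w).map Neg.neg)
    {ω : Ω} (h : ∀ᵐ x, ∫⁻ y, w (y - x) ∂(Ψ ω) = γ) :
    γ • (volume : Measure (E d)) = transport (translationKernel Ω μ) ω (Ψ ω) := by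
  refine Measure.ext_of_lintegral _ fun f hf => ?_
  rw [lintegral_transport_translationKernel _ _ _ hf]
  have e : ∀ x, ∫⁻ y, f (y + x) ∂μ = ∫⁻ z, w (x - z) * f z := by
    intro x
    rw [hμ, lintegral_map (by fun_prop) measurable_neg,
      lintegral_withDensity_eq_lintegral_mul _ hw (by fun_prop),
      ← lintegral_sub_left_eq_self _ x]
    refine lintegral_congr fun z => ?_
    simp
  simp_rw [e]
  rw [lintegral_lintegral_swap (by fun_prop), lintegral_smul_measure]
  change (γ : ℝ≥0∞) * _ = _
  rw [← lintegral_const_mul _ hf]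
  refine lintegral_congr_ae ?_
  filter_upwards [h] with x hx
  rw [lintegral_mul_const _ (by fun_prop), hx]

end DensityKernel

/-! ### Decay and moments of the density -/

section Density

variable {d : ℕ}

theorem HasIntegrableDecay.prod_coord_mul {φ : E d → ℝ} (hφc : Continuous φ)
    (hφ : ∀ n : ℕ, ∃ C : ℝ, ∀ x, |φ x| ≤ C * (1 + ‖x‖) ^ (-(n : ℝ))) {q : ℕ}
    (j : Fin q → Fin d) : HasIntegrableDecay fun x => (∏ i, x (j i)) * φ x := by
  -- Of the decay, `q` powers absorb the monomial and `d + 1` remain for integrability.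
  obtain ⟨C, hC⟩ := hφ (q + (d + 1))
  refine ⟨by fun_prop, C, fun x => ?_⟩
  have hx : 0 < 1 + ‖x‖ := by positivity
  have h1 : |∏ i, x (j i)| ≤ (1 + ‖x‖) ^ (q : ℝ) := by
    rw [Real.rpow_natCast]
    refine (abs_prod_coord_le j x).trans ?_
    gcongr
    linarith
  calc |(∏ i, x (j i)) * φ x|
      ≤ (1 + ‖x‖) ^ (q : ℝ) * (C * (1 + ‖x‖) ^ (-((q + (d + 1) : ℕ) : ℝ))) := by
        rw [abs_mul]
        exact mul_le_mul h1 (hC x) (abs_nonneg _) (by positivity)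
    _ = C * (1 + ‖x‖) ^ (-((d + 1 : ℕ) : ℝ)) := by
        rw [mul_left_comm, ← Real.rpow_add hx]
        congr 2
        push_cast
        ring

theorem lintegral_norm_rpow_mul_lt_top {φ : E d → ℝ}
    (hφ : ∀ n : ℕ, ∃ C : ℝ, ∀ x, |φ x| ≤ C * (1 + ‖x‖) ^ (-(n : ℝ))) {p : ℝ} (hp : 0 ≤ p) :
    ∫⁻ x, ‖x‖ₑ ^ p * ENNReal.ofReal (φ x) < ∞ := by
  obtain ⟨C, hC⟩ := hφ (⌈p⌉₊ + (d + 1))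
  refine lt_of_le_of_lt (lintegral_mono fun x => ?_)
    ((integrable_one_add_norm_rpow d).const_mul C).2
  have hx : 0 < 1 + ‖x‖ := by positivity
  rw [← ofReal_norm x, ENNReal.ofReal_rpow_of_nonneg (norm_nonneg x) hp,
    ← ENNReal.ofReal_mul (by positivity)]
  refine (ENNReal.ofReal_le_ofReal ?_).trans (Real.ofReal_le_enorm _)
  have h1 : ‖x‖ ^ p ≤ (1 + ‖x‖) ^ (⌈p⌉₊ : ℝ) :=
    (Real.rpow_le_rpow (norm_nonneg x) (by linarith) hp).trans
      (Real.rpow_le_rpow_of_exponent_le (by linarith [norm_nonneg x]) (Nat.le_ceil p))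
  calc ‖x‖ ^ p * φ x
      ≤ (1 + ‖x‖) ^ (⌈p⌉₊ : ℝ) * (C * (1 + ‖x‖) ^ (-((⌈p⌉₊ + (d + 1) : ℕ) : ℝ))) := by
        refine (mul_le_mul_of_nonneg_left (le_abs_self _) (by positivity)).trans ?_
        exact mul_le_mul h1 (hC x) (abs_nonneg _) (by positivity)
    _ = C * (1 + ‖x‖) ^ (-((d + 1 : ℕ) : ℝ)) := by
        rw [mul_left_comm, ← Real.rpow_add hx]
        congr 2
        push_cast
        ring

end Density

theorem HasIntensity.ae_eq_zero {d : ℕ} {Ω : Type*} [MeasurableSpace Ω] {P : Measure Ω}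
    {Ψ : Kernel Ω (E d)} (hγ : HasIntensity P Ψ 0) : ∀ᵐ ω ∂P, Ψ ω = 0 := by
  have h : ∫⁻ ω, Ψ ω Set.univ ∂P = 0 := by
    rw [← Measure.bind_apply .univ (Kernel.aemeasurable _), hγ]
    simp
  rw [lintegral_eq_zero_iff (Ψ.measurable_coe .univ)] at h
  filter_upwards [h] with ω hω
  exact Measure.measure_univ_eq_zero.1 hω

/-! ### Palm measures -/

section Palm

variable {d : ℕ} {Ω : Type*} [MeasurableSpace Ω] [AddAction (E d) Ω] [MeasurableVAdd₂ (E d) Ω]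
  {P : Measure Ω} {Ψ : Kernel Ω (E d)} {γ : ℝ≥0}

theorem palm_univ (hΨ : IsRandomMeasure Ψ) (hγ : HasIntensity P Ψ γ) (hγ0 : γ ≠ 0) :
    palm P Ψ γ Set.univ = 1 := by
  have h : ∫⁻ ω, Ψ ω (unitCube d) ∂P = γ := by
    rw [← Measure.bind_apply measurableSet_unitCube (Kernel.aemeasurable _), hγ]
    change (γ : ℝ≥0∞) * volume (unitCube d) = γ
    rw [volume_unitCube, mul_one]
  rw [palm_apply P hΨ γ .univ]
  simp only [Set.mem_univ, Set.ofPred_true, Set.univ_inter, h]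
  exact ENNReal.inv_mul_cancel (by exact_mod_cast hγ0) ENNReal.coe_ne_top

/-- Averaging shifts of `ω` over a cube of volume 1 leaves an invariant `P` unchanged, so costs
under this Palm measure are costs under `P`. -/
theorem palm_scaledLebesgue [SFinite P] [VAddInvariantMeasure (E d) Ω P] (hγ0 : γ ≠ 0) :
    palm P (scaledLebesgue Ω d γ) γ = P := by
  have hΦ : IsRandomMeasure (scaledLebesgue Ω d γ) := fun ω => by
    rw [scaledLebesgue, Kernel.const_apply]
    infer_instance
  ext A hA
  have hv : Measurable fun p : Ω × E d => p.2 +ᵥ p.1 := measurable_snd.vadd measurable_fst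
  have h : ∀ ω, scaledLebesgue Ω d γ ω ({x | x +ᵥ ω ∈ A} ∩ unitCube d) =
      γ * ∫⁻ x in unitCube d, A.indicator 1 (x +ᵥ ω) := by
    intro ω
    have hm : MeasurableSet {x : E d | x +ᵥ ω ∈ A} := (hv.comp measurable_prodMk_left) hA
    change (γ : ℝ≥0∞) * volume _ = _
    rw [← Measure.restrict_apply hm, ← lintegral_indicator_one hm]
    rfl
  have hi : Measurable fun p : Ω × E d => A.indicator (1 : Ω → ℝ≥0∞) (p.2 +ᵥ p.1) :=
    (measurable_one.indicator hA).comp hv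
  rw [palm_apply P hΦ γ hA]
  simp_rw [h]
  rw [lintegral_const_mul _ hi.lintegral_prod_right', ← mul_assoc,
    ENNReal.inv_mul_cancel (by exact_mod_cast hγ0) ENNReal.coe_ne_top, one_mul,
    lintegral_lintegral_swap hi.aemeasurable]
  simp_rw [lintegral_vadd_eq_self (P := P) (f := A.indicator 1) (measurable_one.indicator hA),
    lintegral_indicator_one hA]
  rw [setLIntegral_const, volume_unitCube, mul_one]

end Palm

/-! ### Construction of the transports and conclusion -/

section Transport

variable {d : ℕ} {Ω : Type*} [MeasurableSpace Ω] [AddAction (E d) Ω] [MeasurableVAdd₂ (E d) Ω]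
  {P : Measure Ω} [IsProbabilityMeasure P] [VAddInvariantMeasure (E d) Ω P]
  {Ψ : Kernel Ω (E d)} {γ : ℝ≥0}

/-- A random measure with a spectral gap at the origin is transported from and to Lebesgue measure
by invariant kernels with the moments of one probability measure on `ℝ^d`. -/
theorem exists_invariant_transport (hΨ : IsRandomMeasure Ψ) (hinv : IsInvariant Ψ)
    (hsq : IsLocallySquareIntegrable P Ψ) (hγ : HasIntensity P Ψ γ) (hunif : IsInftyUniform P Ψ γ) :
    ∃ (K : Kernel (Ω × E d) (E d)) (μ ν : Measure (E d)), IsMarkovKernel K ∧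
      IsProbabilityMeasure μ ∧ IsProbabilityMeasure ν ∧ IsInvariantKernel K ∧
      (∀ᵐ ω ∂P, Ψ ω = γ • transport K ω volume) ∧
      (∀ᵐ ω ∂P, γ • volume = transport (translationKernel Ω ν) ω (Ψ ω)) ∧
      (∀ p : ℝ, 0 ≤ p → ∫⁻ x, ‖x‖ₑ ^ p ∂μ < ∞) ∧
      (∀ p : ℝ, 0 ≤ p → ∫⁻ x, ‖x‖ₑ ^ p ∂ν < ∞) ∧
      (∀ p : ℝ, absMoment P p K = ∫⁻ x, ‖x‖ₑ ^ p ∂μ) ∧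
      ∀ q : ℕ, ∀ᵐ ω ∂P, momentTensor q (K (ω, 0)) = momentTensor q μ := by
  have := hΨ.isSFiniteKernel
  obtain ⟨m, hm, ε, hε, hmε⟩ := hunif
  obtain ⟨φ, hφc, hφ0, hφ1, hφdec, hφhat⟩ := exists_density_fourierHat_eq_zero d hε
  let w : E d → ℝ≥0∞ := fun x => ENNReal.ofReal (φ x)
  have hw : Measurable w := by fun_prop
  have hdec0 : HasIntegrableDecay φ := by
    simpa using HasIntegrableDecay.prod_coord_mul hφc hφdec (q := 0) Fin.elim0
  have hw1 : ∫⁻ x, w x = 1 := by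
    rw [← ofReal_integral_eq_lintegral_ofReal hdec0.integrable (.of_forall hφ0), hφ1,
      ENNReal.ofReal_one]
  let μ : Measure (E d) := volume.withDensity w
  have hμ : IsProbabilityMeasure μ := ⟨by
    rw [withDensity_apply _ .univ, Measure.restrict_univ, hw1]⟩
  let ν : Measure (E d) := μ.map Neg.neg
  have hν : IsProbabilityMeasure ν := Measure.isProbabilityMeasure_map (by fun_prop)
  have hμp : ∀ p : ℝ, ∫⁻ x, ‖x‖ₑ ^ p ∂μ = ∫⁻ x, ‖x‖ₑ ^ p * ENNReal.ofReal (φ x) := fun p => by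
    rw [lintegral_withDensity_eq_lintegral_mul _ hw (by fun_prop)]
    simp [w, mul_comm]
  have hμfin : ∀ p : ℝ, 0 ≤ p → ∫⁻ x, ‖x‖ₑ ^ p ∂μ < ∞ := fun p hp => by
    rw [hμp]
    exact lintegral_norm_rpow_mul_lt_top hφdec hp
  have hνfin : ∀ p : ℝ, 0 ≤ p → ∫⁻ x, ‖x‖ₑ ^ p ∂ν < ∞ := fun p hp => by
    rw [lintegral_map (by fun_prop) measurable_neg]
    simpa using hμfin p hp
  have hmom : ∀ (q : ℕ) (j : Fin q → Fin d),
      ∀ᵐ ω ∂P, ∫ x, (∏ i, x (j i)) * φ x ∂(Ψ ω) = γ * ∫ x, (∏ i, x (j i)) * φ x :=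
    fun q j => ae_integral_eq_of_fourierHat_eq_zero hΨ hinv hsq hγ hm hmε
      (HasIntegrableDecay.prod_coord_mul hφc hφdec j) (hφhat q j)
  have hmass : ∀ᵐ ω ∂P, ∫⁻ y, w y ∂(Ψ ω) = γ := by
    have h0 := hmom 0 Fin.elim0
    simp only [Finset.univ_eq_empty, Finset.prod_empty, one_mul, hφ1, mul_one] at h0
    filter_upwards [h0, hγ.ae_integrable hdec0.integrable] with ω h1 h2
    rw [← ofReal_integral_eq_lintegral_ofReal h2 (.of_forall hφ0), h1, ENNReal.ofReal_coe_nnreal]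
  have hmass' := ae_ae_lintegral_sub_eq hinv hw hmass
  have hνΨ : ∀ᵐ ω ∂P, γ • volume = transport (translationKernel Ω ν) ω (Ψ ω) := by
    filter_upwards [hmass'] with ω hω
    exact transport_translationKernel_neg hw rfl hω
  -- For zero intensity the factor `γ⁻¹` is useless, but `Ψ` vanishes almost surely and any
  -- invariant kernel with the right moments will do.
  obtain rfl | hγ0 := eq_or_ne γ 0
  · refine ⟨translationKernel Ω μ, μ, ν, inferInstance, hμ, hν,
      isInvariantKernel_translationKernel μ, ?_, hνΨ, hμfin, hνfin, fun p => ?_, fun q => ?_⟩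
    · filter_upwards [hγ.ae_eq_zero] with ω hω
      rw [hω, zero_smul]
    · rw [absMoment_translationKernel, measure_univ, mul_one]
    · exact .of_forall fun ω => by rw [translationKernel_apply_zero]
  have hγ0' : (γ : ℝ≥0∞) ≠ 0 := by exact_mod_cast hγ0
  have hK0 : ∀ᵐ ω ∂P, normalizedKernel Ψ γ w μ (ω, 0) = densityKernel Ψ γ w (ω, 0) := by
    filter_upwards [hmass] with ω hω
    rw [normalizedKernel_of_eq]
    rw [densityKernel_apply_univ hw]
    simp only [sub_zero, hω]
    exact ENNReal.inv_mul_cancel hγ0' ENNReal.coe_ne_top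
  refine ⟨normalizedKernel Ψ γ w μ, μ, ν, inferInstance, hμ, hν,
    isInvariantKernel_normalizedKernel hinv hw μ, ?_, hνΨ, hμfin, hνfin, fun p => ?_, fun q => ?_⟩
  · filter_upwards [hmass'] with ω hω
    exact transport_normalizedKernel_volume hγ0 hw hw1 hω
  -- Absolute moments enter only in mean, so the intensity formula suffices, whereas the moment
  -- tensors need almost sure rigidity.
  · have e : ∀ᵐ ω ∂P, ∫⁻ x, ‖x‖ₑ ^ p ∂(normalizedKernel Ψ γ w μ (ω, 0)) =
        (γ : ℝ≥0∞)⁻¹ * ∫⁻ x, ‖x‖ₑ ^ p * ENNReal.ofReal (φ x) ∂(Ψ ω) := by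
      filter_upwards [hK0] with ω hω
      rw [hω, lintegral_densityKernel hw _ _ (by fun_prop)]
      simp [w, mul_comm]
    rw [absMoment, lintegral_congr_ae e, lintegral_const_mul' _ _ (ENNReal.inv_ne_top.2 hγ0'),
      hγ.lintegral (by fun_prop), ← mul_assoc, ENNReal.inv_mul_cancel hγ0' ENNReal.coe_ne_top,
      one_mul, hμp]
  · filter_upwards [hK0, ae_all_iff.2 (hmom q)] with ω h1 h2
    ext j
    have hμj : momentTensor q μ j = ∫ x, (∏ i, x (j i)) * φ x := by
      rw [momentTensor, integral_withDensity_eq_integral_toReal_smul hw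
        (.of_forall fun x => ENNReal.ofReal_lt_top)]
      refine integral_congr_ae (.of_forall fun x => ?_)
      simp only [w, ENNReal.toReal_ofReal (hφ0 x), smul_eq_mul, mul_comm]
    have hKj : momentTensor q (densityKernel Ψ γ w (ω, 0)) j =
        (γ : ℝ)⁻¹ * ∫ x, (∏ i, x (j i)) * φ x ∂(Ψ ω) := by
      rw [momentTensor, densityKernel_apply hw, integral_withDensity_eq_integral_toReal_smul
        (by fun_prop) (.of_forall fun x => ENNReal.mul_lt_top
          (ENNReal.inv_lt_top.2 (pos_iff_ne_zero.2 hγ0')) ENNReal.ofReal_lt_top),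
        ← integral_const_mul]
      refine integral_congr_ae (.of_forall fun x => ?_)
      simp only [sub_zero, ENNReal.toReal_mul, ENNReal.toReal_inv, ENNReal.coe_toReal,
        ENNReal.toReal_ofReal (hφ0 x), smul_eq_mul]
      ring
    have hγr : (γ : ℝ) ≠ 0 := by exact_mod_cast hγ0
    rw [h1, hKj, h2 j, hμj, inv_mul_cancel_left₀ hγr]

end Transport

end StealthyTransport

open StealthyTransport in
theorem theoremt {d : ℕ} (hd : 1 ≤ d) {Ω : Type*} [MeasurableSpace Ω]
    [AddAction (E d) Ω] [MeasurableVAdd₂ (E d) Ω]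
    (P : Measure Ω) [IsProbabilityMeasure P] [VAddInvariantMeasure (E d) Ω P]
    (Ψ : Kernel Ω (E d)) (hΨ : IsRandomMeasure Ψ) (hinv : IsInvariant Ψ)
    (hsq : IsLocallySquareIntegrable P Ψ) (γ : ℝ≥0) (hγ : HasIntensity P Ψ γ)
    (hunif : IsInftyUniform P Ψ γ) :
    (∃ K L : Kernel (Ω × E d) (E d),
      IsMarkovKernel K ∧ IsMarkovKernel L ∧ IsInvariantKernel K ∧ IsInvariantKernel L ∧
      IsDeterministicKernel L ∧
      (∀ᵐ ω ∂P, Ψ ω = γ • transport K ω volume) ∧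
      (∀ ω, volume = transport L ω volume) ∧
      (∀ q : ℕ, absMoment P q K + absMoment P q L < ∞) ∧
      (∀ q : ℕ, ∀ᵐ ω ∂P, momentTensor q (K (ω, 0)) = momentTensor q (L (ω, 0))) ∧
      (∀ q : ℕ, HasDeterministicMoment P q K)) ∧
    (∀ p : ℝ, 1 ≤ p →
      dDist P p Ψ γ ≤ 2 * dTildeDist P p Ψ γ ∧ dTildeDist P p Ψ γ < ∞) ∧
    (∀ p : ℝ, 1 ≤ p → 0 < γ →
      wassersteinDist P p γ (scaledLebesgue Ω d γ) Ψ < ∞ ∧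
      wassersteinDist P p γ Ψ (scaledLebesgue Ω d γ) < ∞) := by
  obtain ⟨K, μ, ν, hK, hμ, hν, hKinv, hKΨ, hνΨ, hμfin, hνfin, hKabs, hKmom⟩ :=
    exists_invariant_transport hΨ hinv hsq hγ hunif
  have hKfin : ∀ p : ℝ, 0 ≤ p → absMoment P p K < ∞ := fun p hp => by
    rw [hKabs]
    exact hμfin p hp
  have hKdet : ∀ q : ℕ, HasDeterministicMoment P q K := fun q => ⟨_, hKmom q⟩
  refine ⟨⟨K, translationKernel Ω μ, hK, inferInstance, hKinv,
    isInvariantKernel_translationKernel μ, isDeterministicKernel_translationKernel μ, hKΨ,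
    fun ω => (transport_translationKernel_volume μ ω).symm, fun q => ?_, fun q => ?_, hKdet⟩,
    fun p hp => ⟨dDist_le_two_mul_dTildeDist P p Ψ γ, ?_⟩, fun p hp hγ0 => ⟨?_, ?_⟩⟩
  · rw [absMoment_translationKernel, measure_univ, mul_one, ENNReal.add_lt_top]
    exact ⟨hKfin q q.cast_nonneg, hμfin q q.cast_nonneg⟩
  · filter_upwards [hKmom q] with ω hω
    rw [hω, translationKernel_apply_zero]
  · exact lt_of_le_of_lt (sInf_le ⟨K, hK, hKinv, hKΨ, fun q _ _ => hKdet q, rfl⟩)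
      (hKfin p (by linarith))
  · refine lt_of_le_of_lt (sInf_le ⟨K, hK, hKinv, ?_, rfl⟩)
      (ENNReal.rpow_lt_top_of_nonneg (by positivity) ?_)
    · filter_upwards [hKΨ] with ω hω
      rw [hω, scaledLebesgue, Kernel.const_apply, transport, transport, Measure.bind_smul]
    · rw [palm_scaledLebesgue hγ0.ne']
      exact (hKfin p (by linarith)).ne
  -- This kernel does not depend on `ω`, so under the Palm measure of `Ψ` only the total mass 1
  -- matters.
  · refine lt_of_le_of_lt (sInf_le ⟨translationKernel Ω ν, inferInstance,
      isInvariantKernel_translationKernel ν, hνΨ, rfl⟩)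
      (ENNReal.rpow_lt_top_of_nonneg (by positivity) ?_)
    rw [absMoment_translationKernel, palm_univ hΨ hγ hγ0.ne', mul_one]
    exact (hνfin p (by linarith)).ne
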